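/- **Model.** An agent has a private type $\theta\in\Theta=[\underline\theta,\bar\theta]$, $0\le\underline\theta<\bar\theta$, with a continuous density $f>0$ on $\Theta$. He chooses a quality $q\in Q=[0,q_{\max}]$ at cost $c(q)/\theta$, where $c$ is $C^2$ and strictly convex on $Q$, $c(0)=c'(0)=0$, $c'(q)>0$ for $q>0$, and $c(q_{\max})=\bar\theta q_{\max}$. The principal commits to a deterministic rating $\pi:Q\to S$. The agent then chooses $q$ and whether to take the test; the market observes the score $\pi(q)$, or a null signal if he does not take the test, and pays a wage $\omega$ equal to the expected quality given the signal (Bayes' rule on the path; off the path, the mean of some belief on the qualities consistent with the signal). The agent maximizes $\theta\omega-c(q)$. A quality scheme $q:\Theta\to Q$ is *induced* by $\pi$ if it is the quality choice in an equilibrium of this game. The principal maximizes expected quality $\mathbb E[q(\theta)]$, i.e. $v(q,\theta)=q$; a deterministic rating is *optimal* if it induces a quality scheme whose expected quality is at least that of any quality scheme induced by any deterministic rating. *Lower censorship* with minimum standard $q_0\in Q$ reveals $q$ if $q\ge q_0$ and gives "fail" otherwise; the *pass/fail test* with minimum standard $q_0\in Q$ gives "pass" if $q\ge q_0$ and "fail"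 otherwise; the *fully revealing test* is lower censorship with $q_0=0$. The *cutoff type* of the minimum standard $q_0$ is $\theta_0=c(q_0)/q_0$ ($\theta_0=0$ if $q_0=0$). For $\theta\in[0,\bar\theta]$ let $q_i(\theta)$ be the largest solution $q\in Q$ of $\theta q=c(q)$, and let $\theta_c(\theta)=c'(q_i(\theta))$. The density $f$ is *unimodal* if, for some $m\in\Theta$, it is (weakly) increasing on $[\underline\theta,m]$ and (weakly) decreasing on $[m,\bar\theta]$; a *mode* is a maximizer of $f$ on $\Theta$. Increasing and decreasing are meant weakly, on $\Theta$. **Proposition.** Let $v(q,\theta)=q$. 1. If $f$ is unimodal, then some lower censorship rating is optimal among deterministic ratings. 2. If $f$ is increasing, or if $f$ is unimodal and $\theta_c(\underline\theta)\ge\bar\theta$, then some pass/fail test is optimal. 3. If $f$ is decreasing, then there is an optimal lower censorship rating without exclusion: its cutoff type is at most $\underline\theta$, and it induces an optimal quality scheme in which every type $\theta>0$ chooses a positive quality. 4. The fully revealing test is optimal if and only if $f$ is decreasing and $\underline\theta=0$. 5. Let $f$ be unimodal. For every mode $\theta_m$ of $f$ there is an optimal lower censorship rating whose cutoff type $\theta_0^*$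 satisfies $\theta_0^*\in[\theta_c^{-1}(\theta_m),\theta_m]$. Conversely, if a lower censorship rating or a pass/fail test is optimal, then its cutoff type lies in $[\theta_c^{-1}(\theta_m),\theta_m]$ for some mode $\theta_m$ of $f$ (so for the mode, if it is unique). -/

import Mathlib

open MeasureTheory Set

/-- The primitives of the rating-design model, with multiplicatively separable cost `c(q)/θ`.
* Types lie in `Θ = [θlo, θhi] ⊆ [0, ∞)`, with a continuous positive density `f`.
* Qualities lie in `Q = [0, qmax]`, where `qmax` is the quality at which the highest type is
  indifferent to the outside option: `c qmax = θhi * qmax`.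
* The cost `c` is `C²` on `Q`, strictly convex, with `c(0) = c'(0) = 0` and `c' > 0` off `0`. -/
structure RatingModel where
  θlo : ℝ
  θhi : ℝ
  qmax : ℝ
  /-- density of the type distribution -/
  f : ℝ → ℝ
  /-- cost function -/
  c : ℝ → ℝ
  θlo_nonneg : 0 ≤ θlo
  θlo_lt_θhi : θlo < θhi
  f_cont : ContinuousOn f (Icc θlo θhi)
  f_pos : ∀ θ ∈ Icc θlo θhi, 0 < f θ
  f_integral : ∫ θ in θlo..θhi, f θ = 1
  qmax_pos : 0 < qmax
  c_contDiff : ContDiffOn ℝ 2 c (Icc 0 qmax)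
  c_zero : c 0 = 0
  c_deriv_zero : derivWithin c (Icc 0 qmax) 0 = 0
  c_deriv_pos : ∀ q ∈ Ioc 0 qmax, 0 < derivWithin c (Icc 0 qmax) q
  c_strictConvex : StrictConvexOn ℝ (Icc 0 qmax) c
  c_qmax : c qmax = θhi * qmax

namespace RatingModel

noncomputable section

variable (M : RatingModel)

/-- The type space `[θlo, θhi]`. -/
abbrev Typ : Type := Icc M.θlo M.θhi

/-- The set of qualities `[0, qmax]`. -/
def Q : Set ℝ := Icc 0 M.qmax

/-- The distribution of types. -/
def F : Measure M.Typ :=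
  ((volume : Measure ℝ).comap Subtype.val).withDensity (fun θ : M.Typ => ENNReal.ofReal (M.f θ))

/-- The marginal cost `c'` (one-sided at the endpoints of `Q`). -/
def marginalCost (q : ℝ) : ℝ := derivWithin M.c M.Q q

/-- The quality `q_i(θ)` that leaves type `θ` indifferent to the outside option: the largest
solution in `Q` of `θ q = c(q)` (for `θ > 0` the only other one is `0`; `q_i(0) = 0`). -/
def qi (θ : ℝ) : ℝ := sSup {q ∈ M.Q | θ * q = M.c q}

/-- `θ_c(θ) = c'(q_i(θ))`, the type that would choose `q_i(θ)` under full revelation. -/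
def thetaC (θ : ℝ) : ℝ := M.marginalCost (M.qi θ)

/-- The inverse of `θ_c`, as a function on `[0, θhi]`. -/
def thetaCInv : ℝ → ℝ := Function.invFunOn M.thetaC (Icc 0 M.θhi)

/-- The cutoff type `θ₀ = c(q₀)/q₀` of a minimum standard `q₀`. For `q₀ = 0` it is `0`, which is
the limit of `c(q)/q` at `0`. -/
def cutoff (q₀ : ℝ) : ℝ := M.c q₀ / q₀

/-- The signal that the market observes: the score `π q` if an agent of quality `q` takes the
test, and the null signal `none` if he does not. -/
def signal {S : Type*} (π : ℝ → S) (q : ℝ) (takes : Bool) : Option S :=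
  if takes = true then some (π q) else none

/-- The σ-algebra on types generated by a signal map, the set of signals carrying the finest
σ-algebra for which this map is measurable. -/
abbrev signalSigma {α : Type*} (sig : M.Typ → α) : MeasurableSpace M.Typ :=
  (MeasurableSpace.map sig inferInstance).comap sig

/-- Equilibrium of the game induced by the deterministic rating `π : Q → S` (only the values of
`π` on `Q` matter): types `θ` choose the quality `q θ` and take the test iff `takes θ`, and the
market pays the wage `ω s` after the signal `s`. The payoff of type `θ` is `θ ω(s) - c(q)`, which
is `θ` times `ω(s) - c(q)/θ`. -/
structure IsEquilibrium {S : Type*} (π : ℝ → S) (q : M.Typ → ℝ) (takes : M.Typ → Bool)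
    (ω : Option S → ℝ) : Prop where
  measurable : Measurable q
  mem : ∀ θ, q θ ∈ M.Q
  /-- on the path, the wage is the conditional expectation of quality given the signal -/
  bayes : (fun θ => ω (signal π (q θ) (takes θ)))
    =ᵐ[M.F] M.F[q | M.signalSigma (fun θ => signal π (q θ) (takes θ))]
  /-- at any score, the wage is the mean of a belief on the qualities that obtain this score -/
  wage_score : ∀ x ∈ M.Q, ω (some (π x)) ∈ convexHull ℝ {y ∈ M.Q | π y = π x}
  wage_null : ω none ∈ M.Q
  /-- every type chooses quality and participation optimally -/
  optimal : ∀ θ : M.Typ, ∀ x ∈ M.Q, ∀ t : Bool,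
    (θ : ℝ) * ω (signal π x t) - M.c x ≤ (θ : ℝ) * ω (signal π (q θ) (takes θ)) - M.c (q θ)

/-- The rating `π` induces (implements) the quality scheme `q`. -/
def Induces {S : Type*} (π : ℝ → S) (q : M.Typ → ℝ) : Prop :=
  ∃ takes ω, M.IsEquilibrium π q takes ω

/-- The principal's expected payoff from a quality scheme, for the utility function `v(q, θ)`. -/
def payoff (v : ℝ → ℝ → ℝ) (q : M.Typ → ℝ) : ℝ := ∫ θ, v (q θ) θ ∂M.F

/-- The deterministic rating `π`, inducing the scheme `q`, is optimal for the principal among all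
deterministic ratings and all quality schemes which these induce. -/
def IsOptimal (v : ℝ → ℝ → ℝ) {S : Type*} (π : ℝ → S) (q : M.Typ → ℝ) : Prop :=
  M.Induces π q ∧
    ∀ (S' : Type) (π' : ℝ → S') (q' : M.Typ → ℝ), M.Induces π' q' → M.payoff v q' ≤ M.payoff v q

/-- Lower censorship with minimum standard `q₀`; the score `none` is "fail". -/
def lowerCensorship (q₀ : ℝ) (x : ℝ) : Option ℝ :=
  if q₀ ≤ x then some x else none

/-- The pass/fail test with minimum standard `q₀`; `true` is "pass". -/
def passFail (q₀ : ℝ) (x : ℝ) : Bool :=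
  if q₀ ≤ x then true else false

/-- The fully revealing test. -/
def fullyRevealing : ℝ → Option ℝ := lowerCensorship 0

/-- No exclusion: every type (except possibly type `0`, for whom any effort is
prohibitively costly) chooses a positive quality. -/
def NoExclusion (q : M.Typ → ℝ) : Prop := ∀ θ : M.Typ, 0 < (θ : ℝ) → 0 < q θ

/-- The density is (weakly) unimodal. -/
def Unimodal : Prop :=
  ∃ m ∈ Icc M.θlo M.θhi, MonotoneOn M.f (Icc M.θlo m) ∧ AntitoneOn M.f (Icc m M.θhi)

/-- `m` is a mode of the density. -/
def IsMode (m : ℝ) : Prop := m ∈ Icc M.θlo M.θhi ∧ ∀ θ ∈ Icc M.θlo M.θhi, M.f θ ≤ M.f m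

/-- The principal's utility under quality maximization, `v(q, θ) = q`. -/
def quality : ℝ → ℝ → ℝ := fun q _ => q

end

end RatingModel

namespace RatingModel

noncomputable section

variable (M : RatingModel)

/-! ### The cost function -/

/-! The wage depends only on the signal, so an agent takes the cheapest quality behind his signal.
Types with equal signals thus choose equal qualities, and Bayes' rule pays almost every type its own
quality. An equilibrium scheme is therefore, almost everywhere, a selection of optimal choices from
a compact menu containing `0` (`IsEquilibrium.exists_menu`); conversely, rounding qualities down to
a menu implements it (`IsMenu.induces_round`). Rating design becomes delegation: maximize the
integral of `f * sel D` over menus `D`.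

The choice `sel D` is the derivative of the convex indirect utility `env D`. If `f` peaks at `m`,
its superlevel sets are intervals with endpoints `l ≤ m ≤ r`; slicing `f` into layers turns expected
quality into the integral of `env D r - env D l` over the levels `t` in `(0, f m)`. A menu with
lower indirect utility to the left of `m` and higher to the right is thus better
(`UnimodalAt.menuValue_le`). Given `D`, such a menu is lower censorship with the standard `x`, at or
above the first best of `m`, that gives `m` the utility `env D m` (`IsMenu.exists_lowerMenu`).
Compactness then yields a best standard with `cutoff x ≤ m ≤ marginalCost x`. A peak at `θhi` makes
qualities above `x` irrelevant, so pass/fail suffices; a peak at `θlo` rules out exclusion. Strict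
versions of the comparison locate every optimal cutoff.

Full revelation fails if `θlo > 0`, since a standard with cutoff `θlo` raises quality without
excluding anyone. It also fails if `f a < f b` for some `a < b`: the distribution function then lies
above a tangent on `[a, b]`, touching it at an interior `t`, and removing a gap of qualities between
whose ends `t` is indifferent pays (`menuValue_gapMenu_sub`). -/

lemma zero_mem_Q : (0 : ℝ) ∈ M.Q := ⟨le_rfl, M.qmax_pos.le⟩

lemma qmax_mem_Q : M.qmax ∈ M.Q := ⟨M.qmax_pos.le, le_rfl⟩

lemma isCompact_Q : IsCompact M.Q := isCompact_Icc

lemma c_continuousOn : ContinuousOn M.c M.Q := M.c_contDiff.continuousOn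

lemma c_differentiableOn : DifferentiableOn ℝ M.c M.Q :=
  M.c_contDiff.differentiableOn (by norm_num)

lemma marginalCost_continuousOn : ContinuousOn M.marginalCost M.Q :=
  M.c_contDiff.continuousOn_derivWithin (uniqueDiffOn_Icc M.qmax_pos) (by norm_num)

lemma marginalCost_strictMonoOn : StrictMonoOn M.marginalCost M.Q :=
  M.c_strictConvex.strictMonoOn_derivWithin M.c_differentiableOn

lemma marginalCost_zero : M.marginalCost 0 = 0 := M.c_deriv_zero

/-- The graph of the cost function lies strictly above its tangents. -/
lemma tangent_lt {x y : ℝ} (hx : x ∈ M.Q) (hy : y ∈ M.Q) (hxy : x ≠ y) :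
    M.c x + M.marginalCost x * (y - x) < M.c y := by
  rcases lt_or_gt_of_ne hxy with h | h
  · have := M.c_strictConvex.derivWithin_lt_slope hx hy h (M.c_differentiableOn x hx)
    rw [slope_def_field, lt_div_iff₀ (sub_pos.2 h)] at this
    have h' : M.marginalCost x * (y - x) < M.c y - M.c x := this
    linarith
  · have := M.c_strictConvex.slope_lt_derivWithin hy hx h (M.c_differentiableOn x hx)
    rw [slope_def_field, div_lt_iff₀ (sub_pos.2 h)] at this
    have h' : M.c x - M.c y < M.marginalCost x * (x - y) := this
    linarith

lemma tangent_le {x y : ℝ} (hx : x ∈ M.Q) (hy : y ∈ M.Q) :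
    M.c x + M.marginalCost x * (y - x) ≤ M.c y := by
  rcases eq_or_ne x y with rfl | h
  · simp
  · exact (M.tangent_lt hx hy h).le

lemma marginalCost_nonneg {x : ℝ} (hx : x ∈ M.Q) : 0 ≤ M.marginalCost x := by
  rw [← M.marginalCost_zero]
  exact M.marginalCost_strictMonoOn.monotoneOn M.zero_mem_Q hx hx.1

lemma c_pos {x : ℝ} (hx : x ∈ M.Q) (h : 0 < x) : 0 < M.c x := by
  have := M.tangent_lt M.zero_mem_Q hx h.ne
  rw [M.marginalCost_zero, M.c_zero] at this
  linarith

lemma c_strictMonoOn : StrictMonoOn M.c M.Q := by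
  intro x hx y hy h
  have := M.tangent_lt hx hy h.ne
  nlinarith [mul_nonneg (M.marginalCost_nonneg hx) (sub_nonneg.2 h.le)]

lemma c_nonneg {x : ℝ} (hx : x ∈ M.Q) : 0 ≤ M.c x := by
  rw [← M.c_zero]
  exact M.c_strictMonoOn.monotoneOn M.zero_mem_Q hx hx.1

/-- At `qmax` the average cost is `θhi`, and strict convexity puts marginal cost above average cost.
Hence the first best of every type lies in `Q`. -/
lemma θhi_lt_marginalCost_qmax : M.θhi < M.marginalCost M.qmax := by
  have := M.tangent_lt M.qmax_mem_Q M.zero_mem_Q M.qmax_pos.ne'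
  rw [M.c_zero, M.c_qmax] at this
  have h2 : 0 < (M.marginalCost M.qmax - M.θhi) * M.qmax := by linarith
  linarith [pos_of_mul_pos_left h2 M.qmax_pos.le]

/-- Every type in `[0, θhi]` has a quality that is its first best. -/
lemma exists_marginalCost_eq {θ : ℝ} (hθ : θ ∈ Icc 0 M.θhi) :
    ∃ x ∈ M.Q, M.marginalCost x = θ := by
  have := intermediate_value_Icc M.qmax_pos.le M.marginalCost_continuousOn
  obtain ⟨x, hx, h⟩ := this
    ⟨M.marginalCost_zero.le.trans hθ.1, hθ.2.trans M.θhi_lt_marginalCost_qmax.le⟩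
  exact ⟨x, hx, h⟩

lemma lt_of_marginalCost_lt {x y : ℝ} (hx : x ∈ M.Q) (hy : y ∈ M.Q)
    (h : M.marginalCost x < M.marginalCost y) : x < y :=
  (M.marginalCost_strictMonoOn.lt_iff_lt hx hy).1 h

lemma le_of_marginalCost_le {x y : ℝ} (hx : x ∈ M.Q) (hy : y ∈ M.Q)
    (h : M.marginalCost x ≤ M.marginalCost y) : x ≤ y :=
  (M.marginalCost_strictMonoOn.le_iff_le hx hy).1 h

/-- The first-best quality is the unique maximizer of the agent's payoff. -/
lemma payoff_lt_of_marginalCost_eq {θ x y : ℝ} (hx : x ∈ M.Q) (hy : y ∈ M.Q)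
    (h : M.marginalCost x = θ) (hne : x ≠ y) : θ * y - M.c y < θ * x - M.c x := by
  have := M.tangent_lt hx hy hne
  rw [h] at this
  linarith

lemma payoff_le_of_marginalCost_eq {θ x y : ℝ} (hx : x ∈ M.Q) (hy : y ∈ M.Q)
    (h : M.marginalCost x = θ) : θ * y - M.c y ≤ θ * x - M.c x := by
  have := M.tangent_le hx hy
  rw [h] at this
  linarith

lemma payoff_pos_of_marginalCost_eq {θ x : ℝ} (hx : x ∈ M.Q) (h : M.marginalCost x = θ)
    (hθ : 0 < θ) : 0 < x ∧ 0 < θ * x - M.c x := by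
  have hx0 : 0 < x := by
    apply M.lt_of_marginalCost_lt M.zero_mem_Q hx
    rw [M.marginalCost_zero, h]; exact hθ
  have := M.payoff_lt_of_marginalCost_eq hx M.zero_mem_Q h hx0.ne'
  rw [M.c_zero] at this
  exact ⟨hx0, by linarith⟩

/-- Above the first-best quality, every payoff between `0` and the first-best payoff is attained. -/
lemma exists_payoff_eq {θ q₁ u : ℝ} (hθ : θ ∈ Icc 0 M.θhi) (hq₁ : q₁ ∈ M.Q) (hu : 0 ≤ u)
    (hu' : u ≤ θ * q₁ - M.c q₁) : ∃ x ∈ M.Q, q₁ ≤ x ∧ θ * x - M.c x = u := by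
  have hc : ContinuousOn (fun x => θ * x - M.c x) (Icc q₁ M.qmax) :=
    (continuousOn_const.mul continuousOn_id).sub
      (M.c_continuousOn.mono (Icc_subset_Icc_left hq₁.1))
  have h1 : θ * M.qmax - M.c M.qmax ≤ u := by
    rw [M.c_qmax]
    nlinarith [mul_nonneg (sub_nonneg.2 hθ.2) M.qmax_pos.le]
  obtain ⟨x, hx, h⟩ := intermediate_value_Icc' hq₁.2 hc ⟨h1, hu'⟩
  exact ⟨x, ⟨hq₁.1.trans hx.1, hx.2⟩, hx.1, h⟩

/-! ### Cutoff types -/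

lemma cutoff_mul (x : ℝ) : M.cutoff x * x = M.c x := by
  rcases eq_or_ne x 0 with rfl | h
  · simp [M.c_zero]
  · exact div_mul_cancel₀ _ h

lemma cutoff_zero : M.cutoff 0 = 0 := by simp [cutoff]

lemma cutoff_qmax : M.cutoff M.qmax = M.θhi := by
  rw [cutoff, M.c_qmax, mul_div_cancel_right₀ _ M.qmax_pos.ne']

lemma cutoff_nonneg {x : ℝ} (hx : x ∈ M.Q) : 0 ≤ M.cutoff x :=
  div_nonneg (M.c_nonneg hx) hx.1

lemma cutoff_le_iff {x θ : ℝ} (hx : x ∈ M.Q) (hθ : 0 ≤ θ) :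
    M.cutoff x ≤ θ ↔ 0 ≤ θ * x - M.c x := by
  rcases hx.1.eq_or_lt with rfl | h
  · simp [cutoff_zero, hθ, M.c_zero]
  · rw [cutoff, div_le_iff₀ h, sub_nonneg]

lemma cutoff_lt_iff {x θ : ℝ} (hx : 0 < x) : M.cutoff x < θ ↔ 0 < θ * x - M.c x := by
  rw [cutoff, div_lt_iff₀ hx, sub_pos]

/-- The cutoff is the average cost, that is, the slope of the chord from `0`, which increases by
strict convexity. -/
lemma cutoff_strictMonoOn : StrictMonoOn M.cutoff M.Q := by
  intro x hx y hy h
  have hy0 : 0 < y := hx.1.trans_lt h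
  rcases hx.1.eq_or_lt with rfl | hx0
  · rw [cutoff_zero]
    exact div_pos (M.c_pos hy hy0) hy0
  · have h1 := M.c_strictConvex.slope_strict_mono_adjacent M.zero_mem_Q hy hx0 h
    rw [M.c_zero, sub_zero, sub_zero, div_lt_div_iff₀ hx0 (sub_pos.2 h)] at h1
    rw [cutoff, cutoff, div_lt_div_iff₀ hx0 hy0]
    linarith

lemma cutoff_le_marginalCost {x : ℝ} (hx : x ∈ M.Q) : M.cutoff x ≤ M.marginalCost x := by
  rw [M.cutoff_le_iff hx (M.marginalCost_nonneg hx)]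
  have := M.tangent_le hx M.zero_mem_Q
  rw [M.c_zero] at this
  linarith

lemma cutoff_mem {x : ℝ} (hx : x ∈ M.Q) : M.cutoff x ∈ Icc 0 M.θhi :=
  ⟨M.cutoff_nonneg hx, M.cutoff_qmax ▸ M.cutoff_strictMonoOn.monotoneOn hx M.qmax_mem_Q hx.2⟩

lemma exists_cutoff_eq {θ : ℝ} (hθ : θ ∈ Icc 0 M.θhi) : ∃ x ∈ M.Q, M.cutoff x = θ := by
  obtain ⟨q₁, hq₁, h₁⟩ := M.exists_marginalCost_eq hθ
  have h0 := M.payoff_le_of_marginalCost_eq hq₁ M.zero_mem_Q h₁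
  rw [M.c_zero, mul_zero, sub_zero] at h0
  obtain ⟨x, hx, hqx, h⟩ := M.exists_payoff_eq hθ hq₁ le_rfl h0
  refine ⟨x, hx, ?_⟩
  rcases hx.1.eq_or_lt with rfl | hx0
  · have : q₁ = 0 := le_antisymm hqx hq₁.1
    rw [← h₁, this, M.marginalCost_zero, cutoff_zero]
  · rw [cutoff, div_eq_iff hx0.ne']
    linarith

lemma qi_cutoff {x : ℝ} (hx : x ∈ M.Q) : M.qi (M.cutoff x) = x := by
  apply IsGreatest.csSup_eq
  refine ⟨⟨hx, M.cutoff_mul x⟩, fun y hy => ?_⟩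
  rcases hy.1.1.eq_or_lt with rfl | hy0
  · exact hx.1
  · have : M.cutoff y = M.cutoff x := by
      rw [cutoff, div_eq_iff hy0.ne', hy.2]
    exact (M.cutoff_strictMonoOn.injOn hy.1 hx this).le

lemma thetaC_cutoff {x : ℝ} (hx : x ∈ M.Q) : M.thetaC (M.cutoff x) = M.marginalCost x := by
  rw [thetaC, M.qi_cutoff hx]

lemma thetaC_strictMonoOn : StrictMonoOn M.thetaC (Icc 0 M.θhi) := by
  intro a ha b hb h
  obtain ⟨x, hx, rfl⟩ := M.exists_cutoff_eq ha
  obtain ⟨y, hy, rfl⟩ := M.exists_cutoff_eq hb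
  rw [M.thetaC_cutoff hx, M.thetaC_cutoff hy]
  exact M.marginalCost_strictMonoOn hx hy ((M.cutoff_strictMonoOn.lt_iff_lt hx hy).1 h)

/-- Since `thetaC` sends the cutoff of a quality to its marginal cost, it is increasing and attains
`m` at the cutoff of the first best of `m`. The lower bound on the cutoff thus only says that `x` is
at least this first best. -/
lemma thetaCInv_le_cutoff {m x : ℝ} (hm : m ∈ Icc 0 M.θhi) (hx : x ∈ M.Q)
    (h : m ≤ M.marginalCost x) : M.thetaCInv m ≤ M.cutoff x := by
  obtain ⟨q₁, hq₁, h₁⟩ := M.exists_marginalCost_eq hm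
  have hex : ∃ a ∈ Icc 0 M.θhi, M.thetaC a = m :=
    ⟨M.cutoff q₁, M.cutoff_mem hq₁, by rw [M.thetaC_cutoff hq₁, h₁]⟩
  refine (M.thetaC_strictMonoOn.le_iff_le (Function.invFunOn_mem hex) (M.cutoff_mem hx)).1 ?_
  rw [M.thetaC_cutoff hx]
  exact (Function.invFunOn_eq hex).le.trans h

/-! ### Delegation menus -/

/-- A menu of qualities from which the agent may choose, the outside option `0` being available. -/
structure IsMenu (D : Set ℝ) : Prop where
  compact : IsCompact D
  zero_mem : (0 : ℝ) ∈ D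
  subset : D ⊆ M.Q

/-- `x` is an optimal choice of type `θ` from the menu `D` when quality is paid its value. -/
def IsChoice (D : Set ℝ) (θ x : ℝ) : Prop :=
  x ∈ D ∧ ∀ y ∈ D, θ * y - M.c y ≤ θ * x - M.c x

/-- The largest optimal choice of type `θ` from the menu `D`. -/
def sel (D : Set ℝ) (θ : ℝ) : ℝ := sSup {x | M.IsChoice D θ x}

/-- The indirect utility of type `θ` from the menu `D`. -/
def env (D : Set ℝ) (θ : ℝ) : ℝ := θ * M.sel D θ - M.c (M.sel D θ)

/-- The expected quality when types choose from the menu `D`. -/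
def menuValue (D : Set ℝ) : ℝ := ∫ θ in M.θlo..M.θhi, M.f θ * M.sel D θ

variable {M} {D : Set ℝ}

lemma IsMenu.continuousOn_payoff (hD : M.IsMenu D) (θ : ℝ) :
    ContinuousOn (fun x => θ * x - M.c x) D :=
  (continuousOn_const.mul continuousOn_id).sub (M.c_continuousOn.mono hD.subset)

lemma IsMenu.exists_isGreatest_choice (hD : M.IsMenu D) (θ : ℝ) :
    ∃ x, IsGreatest {x | M.IsChoice D θ x} x := by
  obtain ⟨x₀, hx₀, hmax⟩ := hD.compact.exists_isMaxOn ⟨0, hD.zero_mem⟩ (hD.continuousOn_payoff θ)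
  have hset : {x | M.IsChoice D θ x} =
      D ∩ (fun x => θ * x - M.c x) ⁻¹' Ici (θ * x₀ - M.c x₀) := by
    ext x
    constructor
    · intro hx
      exact ⟨hx.1, hx.2 x₀ hx₀⟩
    · intro hx
      exact ⟨hx.1, fun y hy => (hmax hy).trans hx.2⟩
  have hclosed : IsClosed {x | M.IsChoice D θ x} := by
    rw [hset]
    exact (hD.continuousOn_payoff θ).preimage_isClosed_of_isClosed hD.compact.isClosed isClosed_Ici
  have hcomp : IsCompact {x | M.IsChoice D θ x} :=
    hD.compact.of_isClosed_subset hclosed fun x hx => hx.1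
  exact hcomp.exists_isGreatest ⟨x₀, hx₀, fun y hy => hmax hy⟩

lemma IsMenu.isGreatest_sel (hD : M.IsMenu D) (θ : ℝ) :
    IsGreatest {x | M.IsChoice D θ x} (M.sel D θ) := by
  obtain ⟨x, hx⟩ := hD.exists_isGreatest_choice θ
  rwa [sel, hx.csSup_eq]

lemma IsMenu.isChoice_sel (hD : M.IsMenu D) (θ : ℝ) : M.IsChoice D θ (M.sel D θ) :=
  (hD.isGreatest_sel θ).1

lemma IsMenu.sel_mem (hD : M.IsMenu D) (θ : ℝ) : M.sel D θ ∈ D := (hD.isChoice_sel θ).1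

lemma IsMenu.sel_mem_Q (hD : M.IsMenu D) (θ : ℝ) : M.sel D θ ∈ M.Q := hD.subset (hD.sel_mem θ)

lemma IsMenu.le_sel (hD : M.IsMenu D) {θ x : ℝ} (h : M.IsChoice D θ x) : x ≤ M.sel D θ :=
  (hD.isGreatest_sel θ).2 h

lemma IsMenu.payoff_le_env (hD : M.IsMenu D) (θ : ℝ) {y : ℝ} (hy : y ∈ D) :
    θ * y - M.c y ≤ M.env D θ := (hD.isChoice_sel θ).2 y hy

lemma IsMenu.env_nonneg (hD : M.IsMenu D) (θ : ℝ) : 0 ≤ M.env D θ := by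
  have := hD.payoff_le_env θ hD.zero_mem
  rwa [M.c_zero, mul_zero, sub_zero] at this

/-- Adding the two revealed-preference inequalities cancels the costs. -/
lemma IsChoice.mono {θ θ' x y : ℝ} (hx : M.IsChoice D θ x) (hy : M.IsChoice D θ' y)
    (h : θ < θ') : x ≤ y := by
  have h1 := hx.2 y hy.1
  have h2 := hy.2 x hx.1
  by_contra hc
  push Not at hc
  nlinarith [mul_pos (sub_pos.2 h) (sub_pos.2 hc)]

lemma IsMenu.monotone_sel (hD : M.IsMenu D) : Monotone (M.sel D) := by
  intro a b h
  rcases h.eq_or_lt with rfl | h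
  · exact le_rfl
  · exact (hD.isChoice_sel a).mono (hD.isChoice_sel b) h

/-- Almost every type has a unique optimal choice. -/
lemma IsMenu.eq_sel_of_continuousAt (hD : M.IsMenu D) {θ x : ℝ} (h : M.IsChoice D θ x)
    (hc : ContinuousAt (M.sel D) θ) : x = M.sel D θ := by
  refine le_antisymm (hD.le_sel h) ?_
  have hlim : Filter.Tendsto (M.sel D) (nhdsWithin θ (Iio θ)) (nhds (M.sel D θ)) :=
    hc.tendsto.mono_left nhdsWithin_le_nhds
  -- Types below `θ` choose at most `x`, so the left limit of `sel D` at `θ` is at most `x`.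
  refine le_of_tendsto hlim ?_
  filter_upwards [self_mem_nhdsWithin] with s hs
  exact (hD.isChoice_sel s).mono h hs

/-- A choice is a subgradient of the indirect utility. -/
lemma IsMenu.env_ge (hD : M.IsMenu D) (a b : ℝ) :
    M.env D a + M.sel D a * (b - a) ≤ M.env D b := by
  have := hD.payoff_le_env b (hD.sel_mem a)
  rw [env]
  linarith

lemma IsMenu.continuous_env (hD : M.IsMenu D) : Continuous (M.env D) := by
  have : LipschitzWith (Real.toNNReal M.qmax) (M.env D) := by
    apply LipschitzWith.of_le_add_mul
    intro a b
    rw [Real.coe_toNNReal _ M.qmax_pos.le, Real.dist_eq]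
    have h1 := hD.env_ge a b
    have h2 := hD.sel_mem_Q a
    have h3 : M.sel D a * (a - b) ≤ M.qmax * |a - b| := by
      calc M.sel D a * (a - b) ≤ M.sel D a * |a - b| :=
            mul_le_mul_of_nonneg_left (le_abs_self _) h2.1
        _ ≤ _ := mul_le_mul_of_nonneg_right h2.2 (abs_nonneg _)
    linarith
  exact this.continuous

/-- The subgradient inequalities at `θ` and at `s` squeeze the error between `0` and `(sel D s - sel
D θ) * (s - θ)`. -/
lemma IsMenu.hasDerivAt_env (hD : M.IsMenu D) {θ : ℝ} (hc : ContinuousAt (M.sel D) θ) :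
    HasDerivAt (M.env D) (M.sel D θ) θ := by
  rw [hasDerivAt_iff_isLittleO, Asymptotics.isLittleO_iff]
  intro ε hε
  filter_upwards [Metric.continuousAt_iff'.1 hc ε hε] with s hs
  rw [Real.dist_eq] at hs
  have h1 := hD.env_ge θ s
  have h2 := hD.env_ge s θ
  rw [smul_eq_mul, Real.norm_eq_abs, Real.norm_eq_abs]
  have h0 : 0 ≤ M.env D s - M.env D θ - (s - θ) * M.sel D θ := by linarith
  rw [abs_of_nonneg h0]
  calc _ ≤ (M.sel D s - M.sel D θ) * (s - θ) := by linarith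
    _ ≤ |M.sel D s - M.sel D θ| * |s - θ| := by rw [← abs_mul]; exact le_abs_self _
    _ ≤ _ := mul_le_mul_of_nonneg_right hs.le (abs_nonneg _)

/-- Envelope formula. The monotone `sel D` has only countably many discontinuities, and `env D` is
continuous across them. -/
lemma IsMenu.integral_sel (hD : M.IsMenu D) (a b : ℝ) :
    ∫ θ in a..b, M.sel D θ = M.env D b - M.env D a := by
  refine MeasureTheory.integral_eq_of_hasDerivAt_off_countable _ _
    hD.monotone_sel.countable_not_continuousAt hD.continuous_env.continuousOn ?_
    hD.monotone_sel.intervalIntegrable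
  intro x hx
  exact hD.hasDerivAt_env (by simpa using hx.2)

/-! ### The menus of lower censorship and of pass/fail tests -/

/-- The qualities chosen under lower censorship. -/
def lowerMenu (M : RatingModel) (x : ℝ) : Set ℝ := insert 0 (Icc x M.qmax)

/-- The qualities chosen under a pass/fail test. -/
def passMenu (x : ℝ) : Set ℝ := {0, x}

lemma mem_lowerMenu {x y : ℝ} (hy : y ∈ M.Q) (h : x ≤ y) : y ∈ M.lowerMenu x := Or.inr ⟨h, hy.2⟩

lemma isMenu_lowerMenu {x : ℝ} (hx : x ∈ M.Q) : M.IsMenu (M.lowerMenu x) where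
  compact := isCompact_Icc.insert 0
  zero_mem := Or.inl rfl
  subset := by
    rintro y (rfl | hy)
    · exact M.zero_mem_Q
    · exact ⟨hx.1.trans hy.1, hy.2⟩

lemma isMenu_passMenu {x : ℝ} (hx : x ∈ M.Q) : M.IsMenu (passMenu x) where
  compact := isCompact_singleton.insert 0
  zero_mem := Or.inl rfl
  subset := by
    rintro y (rfl | rfl)
    · exact M.zero_mem_Q
    · exact hx

/-! ### The distribution of types -/

lemma continuous_density : Continuous (fun θ : M.Typ => M.f θ) :=
  continuousOn_iff_continuous_domRestrict.1 M.f_cont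

lemma integral_F (g : ℝ → ℝ) :
    ∫ θ : M.Typ, g θ ∂M.F = ∫ θ in M.θlo..M.θhi, M.f θ * g θ := by
  rw [F, integral_withDensity_eq_integral_toReal_smul
    continuous_density.measurable.ennreal_ofReal (by simp)]
  rw [intervalIntegral.integral_of_le M.θlo_lt_θhi.le, ← integral_Icc_eq_integral_Ioc,
    ← integral_subtype_comap measurableSet_Icc]
  refine integral_congr_ae (Filter.Eventually.of_forall fun θ => ?_)
  simp only [smul_eq_mul]
  rw [ENNReal.toReal_ofReal (M.f_pos θ θ.2).le]

instance : IsFiniteMeasure M.F := by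
  obtain ⟨C, hC⟩ := isCompact_univ.exists_bound_of_continuousOn
    (continuous_density (M := M)).continuousOn
  refine isFiniteMeasure_withDensity ?_
  have hfin : ((volume : Measure ℝ).comap (Subtype.val : M.Typ → ℝ)) univ < ⊤ := by
    rw [(MeasurableEmbedding.subtype_coe measurableSet_Icc).comap_apply, image_univ,
      Subtype.range_coe]
    exact measure_Icc_lt_top
  refine ne_of_lt (lt_of_le_of_lt (lintegral_mono (g := fun _ => ENNReal.ofReal C) fun θ => ?_) ?_)
  · exact ENNReal.ofReal_le_ofReal ((le_abs_self _).trans (hC θ (mem_univ _)))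
  · rw [lintegral_const]
    exact ENNReal.mul_lt_top ENNReal.ofReal_lt_top hfin

lemma ae_F_of_countable {s : Set ℝ} (hs : s.Countable) : ∀ᵐ θ : M.Typ ∂M.F, (θ : ℝ) ∉ s := by
  apply (withDensity_absolutelyContinuous _ _).ae_le
  change _ = (0 : ENNReal)
  rw [(MeasurableEmbedding.subtype_coe measurableSet_Icc).comap_apply]
  refine measure_mono_null ?_ (hs.measure_zero volume)
  rintro _ ⟨θ, hθ, rfl⟩
  simpa using hθ

/-! ### Equilibria -/

/-- A scheme in which almost all types choose optimally from a menu yields the value of the menu. -/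
lemma IsMenu.payoff_eq {D : Set ℝ} (hD : M.IsMenu D) {q : M.Typ → ℝ}
    (h : ∀ᵐ θ : M.Typ ∂M.F, M.IsChoice D θ (q θ)) : M.payoff quality q = M.menuValue D := by
  rw [payoff, menuValue, ← integral_F]
  refine integral_congr_ae ?_
  filter_upwards [h, ae_F_of_countable hD.monotone_sel.countable_not_continuousAt] with θ h1 h2
  exact hD.eq_sel_of_continuousAt h1 (by simpa using h2)

lemma signalSigma_le {α : Type*} (sig : M.Typ → α) : 
    M.signalSigma sig ≤ (inferInstance : MeasurableSpace M.Typ) := by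
  rw [signalSigma, MeasurableSpace.comap_le_iff_le_map]

/-- If quality is a function of the signal, the market learns it. -/
lemma condExp_signalSigma {α : Type*} {sig : M.Typ → α} {q : M.Typ → ℝ} (hq : Measurable q)
    (hQ : ∀ θ, q θ ∈ M.Q) (hfac : ∀ θ θ', sig θ = sig θ' → q θ = q θ') :
    M.F[q | M.signalSigma sig] = q := by
  have hmeas : Measurable[M.signalSigma sig] q := by
    intro B hB
    refine ⟨sig '' (q ⁻¹' B), ?_, ?_⟩
    · have : sig ⁻¹' (sig '' (q ⁻¹' B)) = q ⁻¹' B := by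
        refine Subset.antisymm ?_ (subset_preimage_image _ _)
        rintro θ ⟨θ', hθ', h⟩
        rw [mem_preimage, ← hfac _ _ h]
        exact hθ'
      change MeasurableSet (sig ⁻¹' (sig '' (q ⁻¹' B)))
      rw [this]
      exact hq hB
    · refine Subset.antisymm ?_ (subset_preimage_image _ _)
      rintro θ ⟨θ', hθ', h⟩
      rw [mem_preimage, ← hfac _ _ h]
      exact hθ'
  refine condExp_of_stronglyMeasurable (signalSigma_le sig) hmeas.stronglyMeasurable ?_
  refine Integrable.of_bound hq.aestronglyMeasurable M.qmax
    (Filter.Eventually.of_forall fun θ => ?_)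
  rw [Real.norm_eq_abs, abs_of_nonneg (hQ θ).1]
  exact (hQ θ).2

section Equilibrium

variable {S : Type*} {π : ℝ → S} {q : M.Typ → ℝ} {takes : M.Typ → Bool} {ω : Option S → ℝ}

/-- A deviation that leaves the signal unchanged keeps the wage, so it cannot be cheaper. -/
lemma IsEquilibrium.quality_le (h : M.IsEquilibrium π q takes ω) (θ : M.Typ) {x : ℝ} {t : Bool}
    (hx : x ∈ M.Q) (hs : signal π x t = signal π (q θ) (takes θ)) : q θ ≤ x := by
  have := h.optimal θ x hx t
  rw [hs] at this
  exact (M.c_strictMonoOn.le_iff_le (h.mem θ) hx).1 (by linarith)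

/-- In equilibrium, almost all types are paid their quality. -/
lemma IsEquilibrium.wage_ae_eq (h : M.IsEquilibrium π q takes ω) :
    ∀ᵐ θ : M.Typ ∂M.F, ω (signal π (q θ) (takes θ)) = q θ := by
  have := h.bayes
  rwa [condExp_signalSigma h.measurable h.mem fun θ θ' hs =>
    le_antisymm (h.quality_le θ (h.mem θ') hs.symm) (h.quality_le θ' (h.mem θ) hs)] at this

lemma IsEquilibrium.nonneg (h : M.IsEquilibrium π q takes ω) (θ : M.Typ) :
    0 ≤ θ * ω (signal π (q θ) (takes θ)) - M.c (q θ) := by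
  have := h.optimal θ 0 M.zero_mem_Q false
  rw [M.c_zero] at this
  have h2 : 0 ≤ (θ : ℝ) * ω (signal π 0 false) :=
    mul_nonneg (M.θlo_nonneg.trans θ.2.1) h.wage_null.1
  linarith

/-- Every equilibrium scheme consists of choices from a menu. -/
lemma IsEquilibrium.exists_menu (h : M.IsEquilibrium π q takes ω) :
    ∃ D, M.IsMenu D ∧ M.payoff quality q = M.menuValue D := by
  -- Only the types in `N`, which are almost all, are known to be paid their quality, so the menu
  -- collects their choices. The closure makes it compact, and optimality extends to it by
  -- continuity of `c`.
  set N : Set M.Typ := {θ | ω (signal π (q θ) (takes θ)) = q θ} with hN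
  have hsub : insert 0 (closure (q '' N)) ⊆ M.Q := by
    refine insert_subset M.zero_mem_Q (closure_minimal ?_ M.isCompact_Q.isClosed)
    rintro _ ⟨θ, -, rfl⟩
    exact h.mem θ
  have hclosed : IsClosed (insert 0 (closure (q '' N))) := by
    rw [insert_eq]
    exact isClosed_singleton.union isClosed_closure
  have hD : M.IsMenu (insert 0 (closure (q '' N))) :=
    ⟨M.isCompact_Q.of_isClosed_subset hclosed hsub, Or.inl rfl, hsub⟩
  refine ⟨_, hD, hD.payoff_eq ?_⟩
  filter_upwards [h.wage_ae_eq] with θ hθ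
  refine ⟨Or.inr (subset_closure ⟨θ, hθ, rfl⟩), ?_⟩
  have h0 := h.nonneg θ
  rw [hθ] at h0
  rintro y (rfl | hy)
  · rw [M.c_zero]
    linarith
  · have hcont : ContinuousOn (fun x => (θ : ℝ) * x - M.c x) (closure (q '' N)) :=
      (hD.continuousOn_payoff θ).mono (subset_insert _ _)
    have himg : MapsTo (fun x => (θ : ℝ) * x - M.c x) (q '' N)
        (Iic ((θ : ℝ) * q θ - M.c (q θ))) := by
      rintro _ ⟨θ', hθ', rfl⟩
      have := h.optimal θ (q θ') (h.mem θ') (takes θ')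
      have hθ'' : ω (signal π (q θ') (takes θ')) = q θ' := hθ'
      rw [hθ, hθ''] at this
      exact this
    have := himg.closure_of_continuousOn hcont hy
    rwa [isClosed_Iic.closure_eq] at this

/-- A menu is implemented by a rating if its elements are paid their quality, and every tested
quality is paid an element of the menu below it. -/
lemma IsMenu.isEquilibrium_sel {D : Set ℝ} (hD : M.IsMenu D) (h0 : ω none = 0)
    (hpath : ∀ x ∈ D, ω (some (π x)) = x)
    (hscore : ∀ x ∈ M.Q, ω (some (π x)) ∈ convexHull ℝ {y ∈ M.Q | π y = π x})
    (hdev : ∀ x ∈ M.Q, ω (some (π x)) ∈ D ∧ ω (some (π x)) ≤ x) :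
    M.IsEquilibrium π (fun θ : M.Typ => M.sel D θ) (fun _ => true) ω where
  measurable := hD.monotone_sel.measurable.comp measurable_subtype_coe
  mem θ := hD.sel_mem_Q θ
  bayes := by
    have hw : (fun θ : M.Typ => ω (signal π (M.sel D θ) true)) = fun θ : M.Typ => M.sel D θ := by
      funext θ
      simpa [signal] using hpath _ (hD.sel_mem θ)
    rw [condExp_signalSigma (q := fun θ : M.Typ => M.sel D θ)
      (hD.monotone_sel.measurable.comp measurable_subtype_coe) (fun θ => hD.sel_mem_Q θ), hw]
    intro θ θ' hs
    have := congrArg ω hs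
    simpa [signal, hpath _ (hD.sel_mem _)] using this
  wage_score := hscore
  wage_null := by rw [h0]; exact M.zero_mem_Q
  optimal := by
    intro θ x hx t
    have hval : (θ : ℝ) * ω (signal π (M.sel D θ) true) - M.c (M.sel D θ) = M.env D θ := by
      simp [signal, hpath _ (hD.sel_mem _), env]
    rw [hval]
    cases t with
    | true =>
      -- Quality `x` is paid an element of `D` that costs no more than `x`, so producing that
      -- element itself is at least as good.
      obtain ⟨h1, h2⟩ := hdev x hx
      have h3 := hD.payoff_le_env θ h1
      have h4 := M.c_strictMonoOn.monotoneOn (hD.subset h1) hx h2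
      simp only [signal, if_true]
      linarith
    | false =>
      have := hD.env_nonneg θ
      have := M.c_nonneg hx
      simp only [signal, Bool.false_eq_true, if_false, h0]
      linarith

end Equilibrium

lemma induces_lowerCensorship {x : ℝ} (hx : x ∈ M.Q) :
    M.Induces (lowerCensorship x) (fun θ : M.Typ => M.sel (M.lowerMenu x) θ) := by
  -- Signals have type `Option (Option ℝ)`: `bind id` merges the null signal with "fail", and both
  -- are paid `0`.
  refine ⟨fun _ => true, fun s => (s.bind id).getD 0,
    (isMenu_lowerMenu hx).isEquilibrium_sel rfl ?_ ?_ ?_⟩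
  · rintro y (rfl | hy)
    · by_cases h : x ≤ 0 <;> simp [lowerCensorship, h]
    · simp [lowerCensorship, hy.1]
  · intro y hy
    apply subset_convexHull
    by_cases h : x ≤ y
    · simp [lowerCensorship, h, hy]
    · have h0 : 0 < x := hy.1.trans_lt (not_le.1 h)
      simp [lowerCensorship, h, h0, M.zero_mem_Q]
  · intro y hy
    by_cases h : x ≤ y
    · simp [lowerCensorship, h, mem_lowerMenu hy h]
    · simp [lowerCensorship, h, hy.1, (isMenu_lowerMenu hx).zero_mem]

lemma induces_passFail {x : ℝ} (hx : x ∈ M.Q) :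
    M.Induces (passFail x) (fun θ : M.Typ => M.sel (passMenu x) θ) := by
  refine ⟨fun _ => true, fun s => if s = some true then x else 0,
    (isMenu_passMenu hx).isEquilibrium_sel (by simp) ?_ ?_ ?_⟩
  · rintro y (rfl | rfl)
    · by_cases h : x ≤ 0
      · simp [passFail, le_antisymm h hx.1]
      · simp [passFail, h]
    · simp [passFail]
  · intro y hy
    apply subset_convexHull
    by_cases h : x ≤ y
    · simp [passFail, h, hx]
    · have h0 : 0 < x := hy.1.trans_lt (not_le.1 h)
      simp [passFail, h, h0, M.zero_mem_Q]
  · intro y hy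
    by_cases h : x ≤ y
    · simp [passFail, h, passMenu]
    · simp [passFail, h, passMenu, hy.1]

lemma payoff_sel {D : Set ℝ} (hD : M.IsMenu D) :
    M.payoff quality (fun θ : M.Typ => M.sel D θ) = M.menuValue D :=
  hD.payoff_eq (Filter.Eventually.of_forall fun θ => hD.isChoice_sel θ)

/-- All equilibria under lower censorship have the same expected quality. -/
lemma payoff_of_induces_lowerCensorship {x : ℝ} (hx : x ∈ M.Q) {q : M.Typ → ℝ}
    (h : M.Induces (lowerCensorship x) q) :
    M.payoff quality q = M.menuValue (M.lowerMenu x) := by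
  obtain ⟨takes, ω, h⟩ := h
  refine (isMenu_lowerMenu hx).payoff_eq ?_
  filter_upwards [h.wage_ae_eq] with θ hθ
  refine ⟨?_, ?_⟩
  · by_cases hq : x ≤ q θ
    · exact mem_lowerMenu (h.mem θ) hq
    · left
      have h0 : ¬ x ≤ 0 := fun h' => hq (h'.trans (h.mem θ).1)
      refine le_antisymm (h.quality_le θ (t := takes θ) M.zero_mem_Q ?_) (h.mem θ).1
      simp [signal, lowerCensorship, hq, h0]
  · have hn := h.nonneg θ
    rw [hθ] at hn
    rintro y (rfl | hy)
    · rw [M.c_zero]; linarith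
    · have hyQ : y ∈ M.Q := ⟨hx.1.trans hy.1, hy.2⟩
      have hw := h.wage_score y hyQ
      -- A revealed score is obtained by a single quality, so consistency of beliefs fixes its wage
      -- even off the path.
      have hset : {z ∈ M.Q | lowerCensorship x z = lowerCensorship x y} ⊆ {y} := by
        rintro z ⟨-, hz⟩
        by_cases hxz : x ≤ z
        · simpa [lowerCensorship, hxz, hy.1] using hz
        · simp [lowerCensorship, hxz, hy.1] at hz
      have hw' := convexHull_min hset (convex_singleton y) hw
      have := h.optimal θ y hyQ true
      rw [hθ] at this
      simp only [signal, if_true] at this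
      rwa [mem_singleton_iff.1 hw'] at this

/-- All equilibria under a pass/fail test have the same expected quality. -/
lemma payoff_of_induces_passFail {x : ℝ} (hx : x ∈ M.Q) {q : M.Typ → ℝ}
    (h : M.Induces (passFail x) q) : M.payoff quality q = M.menuValue (passMenu x) := by
  obtain ⟨takes, ω, h⟩ := h
  refine (isMenu_passMenu hx).payoff_eq ?_
  filter_upwards [h.wage_ae_eq] with θ hθ
  have hn := h.nonneg θ
  rw [hθ] at hn
  have hnone : takes θ = false → q θ = 0 := fun ht =>
    le_antisymm (h.quality_le θ (t := false) M.zero_mem_Q (by simp [signal, ht])) (h.mem θ).1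
  refine ⟨?_, ?_⟩
  · by_cases ht : takes θ = true
    · by_cases hq : x ≤ q θ
      · right
        refine le_antisymm (h.quality_le θ (t := true) hx ?_) hq
        simp [signal, passFail, hq, ht]
      · left
        have h0 : ¬ x ≤ 0 := fun h' => hq (h'.trans (h.mem θ).1)
        refine le_antisymm (h.quality_le θ (t := true) M.zero_mem_Q ?_) (h.mem θ).1
        simp [signal, passFail, hq, h0, ht]
    · exact Or.inl (hnone (by simpa using ht))
  · rintro y (rfl | rfl)
    · rw [M.c_zero]; linarith
    · have hw := h.wage_score y hx
      -- Beliefs after "pass" are supported above the standard, so passing pays at least `y`, on or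
      -- off the path.
      have hset : {z ∈ M.Q | passFail y z = passFail y y} ⊆ Ici y := by
        rintro z ⟨-, hz⟩
        by_contra hc
        have hc' : ¬ y ≤ z := hc
        simp [passFail, hc'] at hz
      have hw' : y ≤ ω (some (passFail y y)) := convexHull_min hset (convex_Ici y) hw
      have := h.optimal θ y hx true
      rw [hθ] at this
      simp only [signal, if_true] at this
      have := mul_le_mul_of_nonneg_left hw' (M.θlo_nonneg.trans θ.2.1)
      linarith

/-- The menu `D` yields the highest expected quality. -/
def IsBestMenu (M : RatingModel) (D : Set ℝ) : Prop :=
  ∀ D', M.IsMenu D' → M.menuValue D' ≤ M.menuValue D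

lemma isOptimal_sel {D : Set ℝ} (hD : M.IsMenu D) {S : Type*} {π : ℝ → S}
    (h : M.Induces π (fun θ : M.Typ => M.sel D θ)) (hbest : M.IsBestMenu D) :
    M.IsOptimal quality π (fun θ : M.Typ => M.sel D θ) := by
  refine ⟨h, ?_⟩
  rintro S' π' q' ⟨takes, ω, h'⟩
  obtain ⟨D', hD', hpay⟩ := h'.exists_menu
  rw [hpay, payoff_sel hD]
  exact hbest D' hD'

/-- Every menu is implemented by the rating that rounds qualities down to the menu. -/
lemma IsMenu.induces_round {D : Set ℝ} (hD : M.IsMenu D) :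
    M.Induces (fun x => sSup (D ∩ Iic x)) (fun θ : M.Typ => M.sel D θ) := by
  have hmem : ∀ x ∈ M.Q, sSup (D ∩ Iic x) ∈ D ∩ Iic x := fun x hx =>
    (hD.compact.inter_right isClosed_Iic).sSup_mem ⟨0, hD.zero_mem, hx.1⟩
  have hfix : ∀ x ∈ D, sSup (D ∩ Iic x) = x := fun x hx =>
    IsGreatest.csSup_eq ⟨⟨hx, mem_Iic.2 le_rfl⟩, fun y hy => hy.2⟩
  refine ⟨fun _ => true, fun s => s.getD 0, hD.isEquilibrium_sel rfl ?_ ?_ ?_⟩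
  · exact hfix
  · intro x hx
    refine subset_convexHull ℝ _ ⟨hD.subset (hmem x hx).1, ?_⟩
    exact hfix _ (hmem x hx).1
  · intro x hx
    exact hmem x hx

/-- Since rounding implements every menu, an optimal rating competes against all of them. -/
lemma IsOptimal.isBestMenu {D : Set ℝ} {S : Type*} {π : ℝ → S} {q : M.Typ → ℝ}
    (h : M.IsOptimal quality π q) (hq : M.payoff quality q = M.menuValue D) :
    M.IsBestMenu D := by
  intro D' hD'
  rw [← payoff_sel hD', ← hq]
  exact h.2 _ _ _ hD'.induces_round

lemma isOptimal_lowerCensorship {x : ℝ} (hx : x ∈ M.Q) (h : M.IsBestMenu (M.lowerMenu x)) :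
    M.IsOptimal quality (lowerCensorship x) (fun θ : M.Typ => M.sel (M.lowerMenu x) θ) :=
  isOptimal_sel (isMenu_lowerMenu hx) (induces_lowerCensorship hx) h

lemma isOptimal_passFail {x : ℝ} (hx : x ∈ M.Q) (h : M.IsBestMenu (passMenu x)) :
    M.IsOptimal quality (passFail x) (fun θ : M.Typ => M.sel (passMenu x) θ) :=
  isOptimal_sel (isMenu_passMenu hx) (induces_passFail hx) h

/-! ### Layer-cake representation of the expected quality -/

/-- Layer-cake formula for the integral of a product with a bounded nonnegative factor. -/
lemma integral_mul_eq_integral_superlevel {μ : Measure ℝ} [IsFiniteMeasure μ] {g h : ℝ → ℝ} {K : ℝ}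
    (hK : 0 ≤ K) (hg : AEMeasurable g μ) (hgK : ∀ᵐ θ ∂μ, 0 ≤ g θ ∧ g θ ≤ K)
    (hh : Integrable h μ) :
    IntervalIntegrable (fun y => ∫ θ, (if y < g θ then h θ else 0) ∂μ) volume 0 K ∧
      ∫ θ, g θ * h θ ∂μ = ∫ y in (0 : ℝ)..K, ∫ θ, (if y < g θ then h θ else 0) ∂μ := by
  set ν : Measure ℝ := volume.restrict (Ioc 0 K) with hν
  have hset : NullMeasurableSet {p : ℝ × ℝ | p.2 < g p.1} (μ.prod ν) :=
    nullMeasurableSet_lt measurable_snd.aemeasurable hg.comp_fst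
  have hint : Integrable (Function.uncurry fun θ y => if y < g θ then h θ else 0) (μ.prod ν) := by
    refine (hh.comp_fst ν).mono ?_ (Filter.Eventually.of_forall fun p => ?_)
    · have := (hh.comp_fst ν).aestronglyMeasurable.indicator₀ hset
      refine this.congr (Filter.Eventually.of_forall fun p => ?_)
      simp [Function.uncurry, indicator]
    · simp only [Function.uncurry]
      split_ifs <;> simp
  refine ⟨?_, ?_⟩
  · rw [intervalIntegrable_iff_integrableOn_Ioc_of_le hK]
    exact hint.integral_prod_right
  · rw [intervalIntegral.integral_of_le hK, ← integral_integral_swap hint]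
    refine integral_congr_ae ?_
    filter_upwards [hgK] with θ hθ
    have h1 : (fun y => if y < g θ then h θ else 0) = (Iio (g θ)).indicator fun _ => h θ := by
      funext y
      simp [indicator]
    have h2 : Iio (g θ) ∩ Ioc 0 K = Ioo 0 (g θ) := by
      ext y
      simp only [mem_inter_iff, mem_Iio, mem_Ioc, mem_Ioo]
      constructor
      · rintro ⟨h1, h2, -⟩
        exact ⟨h2, h1⟩
      · rintro ⟨h1, h2⟩
        exact ⟨h2, h1, h2.le.trans hθ.2⟩
    rw [h1, integral_indicator measurableSet_Iio, hν, Measure.restrict_restrict measurableSet_Iio,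
      h2, setIntegral_const, Real.volume_real_Ioo_of_le hθ.1]
    simp

/-- The density is unimodal with peak at `m`. -/
structure UnimodalAt (M : RatingModel) (m : ℝ) : Prop where
  mem : m ∈ Icc M.θlo M.θhi
  mono : MonotoneOn M.f (Icc M.θlo m)
  anti : AntitoneOn M.f (Icc m M.θhi)

lemma UnimodalAt.le {m : ℝ} (hm : M.UnimodalAt m) {θ : ℝ} (hθ : θ ∈ Icc M.θlo M.θhi) :
    M.f θ ≤ M.f m := by
  rcases le_total θ m with h | h
  · exact hm.mono ⟨hθ.1, h⟩ ⟨hm.mem.1, le_rfl⟩ h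
  · exact hm.anti ⟨le_rfl, hm.mem.2⟩ ⟨h, hθ.2⟩ h

/-- Between the given peak `k` and the mode `m`, the density is at least `f m`, hence constant, so
any mode can serve as the peak. -/
lemma Unimodal.unimodalAt (h : M.Unimodal) {m : ℝ} (hm : M.IsMode m) : M.UnimodalAt m := by
  obtain ⟨k, hk, h1, h2⟩ := h
  refine ⟨hm.1, ?_, ?_⟩
  · rcases le_total m k with hmk | hmk
    · exact h1.mono (Icc_subset_Icc_right hmk)
    · intro a ha b hb hab
      rcases le_total b k with hbk | hbk
      · exact h1 ⟨ha.1, hab.trans hbk⟩ ⟨hb.1, hbk⟩ hab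
      · have h3 := h2 ⟨hbk, hb.2.trans hm.1.2⟩ ⟨hmk, hm.1.2⟩ hb.2
        exact (hm.2 a ⟨ha.1, ha.2.trans hm.1.2⟩).trans h3
  · rcases le_total k m with hmk | hmk
    · exact h2.mono (Icc_subset_Icc_left hmk)
    · intro a ha b hb hab
      rcases le_total k a with hbk | hbk
      · exact h2 ⟨hbk, ha.2⟩ ⟨hbk.trans hab, hb.2⟩ hab
      · have h3 := h1 ⟨hm.1.1, hmk⟩ ⟨hm.1.1.trans ha.1, hbk⟩ ha.1
        exact (hm.2 b ⟨hm.1.1.trans hb.1, hb.2⟩).trans h3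

lemma UnimodalAt.isMode {m : ℝ} (hm : M.UnimodalAt m) : M.IsMode m := ⟨hm.mem, fun _ h => hm.le h⟩

/-- The superlevel sets of a unimodal density are intervals around the peak. -/
lemma UnimodalAt.exists_superlevel {m t : ℝ} (hm : M.UnimodalAt m) (ht : t < M.f m) :
    ∃ l ∈ Icc M.θlo m, ∃ r ∈ Icc m M.θhi, (∀ θ ∈ Ioo l r, t < M.f θ) ∧
      ∀ θ ∈ Icc M.θlo M.θhi, t < M.f θ → θ ∈ Icc l r := by
  set L := {θ ∈ Icc M.θlo m | t < M.f θ} with hL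
  set R := {θ ∈ Icc m M.θhi | t < M.f θ} with hR
  have hmL : m ∈ L := ⟨⟨hm.mem.1, le_rfl⟩, ht⟩
  have hmR : m ∈ R := ⟨⟨le_rfl, hm.mem.2⟩, ht⟩
  have hLb : BddBelow L := ⟨M.θlo, fun θ h => h.1.1⟩
  have hRb : BddAbove R := ⟨M.θhi, fun θ h => h.1.2⟩
  refine ⟨sInf L, ⟨le_csInf ⟨m, hmL⟩ fun θ h => h.1.1, csInf_le hLb hmL⟩,
    sSup R, ⟨le_csSup hRb hmR, csSup_le ⟨m, hmR⟩ fun θ h => h.1.2⟩, ?_, ?_⟩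
  · intro θ hθ
    rcases le_total θ m with h | h
    · obtain ⟨s, hs, hsθ⟩ := exists_lt_of_csInf_lt ⟨m, hmL⟩ hθ.1
      exact hs.2.trans_le (hm.mono hs.1 ⟨hs.1.1.trans hsθ.le, h⟩ hsθ.le)
    · obtain ⟨s, hs, hsθ⟩ := exists_lt_of_lt_csSup ⟨m, hmR⟩ hθ.2
      exact hs.2.trans_le (hm.anti ⟨h, hsθ.le.trans hs.1.2⟩ hs.1 hsθ.le)
  · intro θ hθ h
    rcases le_total θ m with h' | h'
    · exact ⟨csInf_le hLb ⟨⟨hθ.1, h'⟩, h⟩, h'.trans (le_csSup hRb hmR)⟩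
    · exact ⟨(csInf_le hLb hmL).trans h', le_csSup hRb ⟨⟨h', hθ.2⟩, h⟩⟩

/-- The integral of the choices over a superlevel set of the density. -/
def levelValue (M : RatingModel) (D : Set ℝ) (t : ℝ) : ℝ :=
  ∫ θ in Icc M.θlo M.θhi, if t < M.f θ then M.sel D θ else 0

/-- Up to its endpoints, which are null, the superlevel set is the interval from `l` to `r`, on
which the choices integrate to a difference of indirect utilities. -/
lemma levelValue_eq {D : Set ℝ} (hD : M.IsMenu D) {t l r : ℝ} (hl : M.θlo ≤ l) (hlr : l ≤ r)
    (hr : r ≤ M.θhi) (h1 : ∀ θ ∈ Ioo l r, t < M.f θ)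
    (h2 : ∀ θ ∈ Icc M.θlo M.θhi, t < M.f θ → θ ∈ Icc l r) :
    M.levelValue D t = M.env D r - M.env D l := by
  have hae : (fun θ => if t < M.f θ then M.sel D θ else 0)
      =ᵐ[volume.restrict (Icc M.θlo M.θhi)] (Ioc l r).indicator (M.sel D) := by
    have hcount : ({l, r} : Set ℝ).Countable := by simp
    filter_upwards [ae_restrict_mem measurableSet_Icc,
      ae_restrict_of_ae (hcount.ae_notMem volume)] with θ hθ hne
    simp only [mem_insert_iff, mem_singleton_iff, not_or] at hne
    by_cases h : θ ∈ Ioc l r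
    · rw [indicator_of_mem h, if_pos (h1 θ ⟨h.1, lt_of_le_of_ne h.2 hne.2⟩)]
    · rw [indicator_of_notMem h, if_neg]
      intro ht
      have := h2 θ hθ ht
      exact h ⟨lt_of_le_of_ne this.1 (Ne.symm hne.1), this.2⟩
  have hsub : Ioc l r ∩ Icc M.θlo M.θhi = Ioc l r :=
    inter_eq_left.2 fun θ hθ => ⟨hl.trans hθ.1.le, hθ.2.trans hr⟩
  rw [levelValue, integral_congr_ae hae, integral_indicator measurableSet_Ioc,
    Measure.restrict_restrict measurableSet_Ioc, hsub, ← intervalIntegral.integral_of_le hlr,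
    hD.integral_sel]

lemma UnimodalAt.menuValue_eq {m : ℝ} (hm : M.UnimodalAt m) {D : Set ℝ} (hD : M.IsMenu D) :
    IntervalIntegrable (M.levelValue D) volume 0 (M.f m) ∧
      M.menuValue D = ∫ t in (0 : ℝ)..M.f m, M.levelValue D t := by
  rw [menuValue, intervalIntegral.integral_of_le M.θlo_lt_θhi.le, ← integral_Icc_eq_integral_Ioc]
  refine integral_mul_eq_integral_superlevel (M.f_pos m hm.mem).le
    (M.f_cont.aemeasurable measurableSet_Icc) ?_ ?_
  · filter_upwards [ae_restrict_mem measurableSet_Icc] with θ hθ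
    exact ⟨(M.f_pos θ hθ).le, hm.le hθ⟩
  · exact hD.monotone_sel.locallyIntegrable.integrableOn_isCompact isCompact_Icc

section Comparison

variable {m : ℝ} {D D' : Set ℝ}

lemma UnimodalAt.levelValue_le (hm : M.UnimodalAt m) (hD : M.IsMenu D) (hD' : M.IsMenu D')
    (hleft : ∀ θ ∈ Icc M.θlo m, M.env D' θ ≤ M.env D θ)
    (hright : ∀ θ ∈ Icc m M.θhi, M.env D θ ≤ M.env D' θ) {t : ℝ} (ht : t < M.f m) :
    M.levelValue D t ≤ M.levelValue D' t := by
  obtain ⟨l, hl, r, hr, h1, h2⟩ := hm.exists_superlevel ht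
  rw [levelValue_eq hD hl.1 (hl.2.trans hr.1) hr.2 h1 h2,
    levelValue_eq hD' hl.1 (hl.2.trans hr.1) hr.2 h1 h2]
  linarith [hleft l hl, hright r hr]

lemma UnimodalAt.menuValue_le (hm : M.UnimodalAt m) (hD : M.IsMenu D) (hD' : M.IsMenu D')
    (hleft : ∀ θ ∈ Icc M.θlo m, M.env D' θ ≤ M.env D θ)
    (hright : ∀ θ ∈ Icc m M.θhi, M.env D θ ≤ M.env D' θ) : M.menuValue D ≤ M.menuValue D' := by
  rw [(hm.menuValue_eq hD).2, (hm.menuValue_eq hD').2]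
  exact intervalIntegral.integral_mono_on_of_le_Ioo (M.f_pos m hm.mem).le (hm.menuValue_eq hD).1
    (hm.menuValue_eq hD').1 fun t ht => hm.levelValue_le hD hD' hleft hright ht.2

/-- A strict gain on an interval of levels suffices, the other levels being weakly better. -/
lemma UnimodalAt.menuValue_lt (hm : M.UnimodalAt m) (hD : M.IsMenu D) (hD' : M.IsMenu D')
    (hleft : ∀ θ ∈ Icc M.θlo m, M.env D' θ ≤ M.env D θ)
    (hright : ∀ θ ∈ Icc m M.θhi, M.env D θ ≤ M.env D' θ) {s : ℝ} (hs : 0 ≤ s) (hsm : s < M.f m)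
    (hlt : ∀ t ∈ Ioo s (M.f m), M.levelValue D t < M.levelValue D' t) :
    M.menuValue D < M.menuValue D' := by
  obtain ⟨hi, he⟩ := hm.menuValue_eq hD
  obtain ⟨hi', he'⟩ := hm.menuValue_eq hD'
  have hsub₁ : uIcc 0 s ⊆ uIcc 0 (M.f m) := by
    rw [uIcc_of_le hs, uIcc_of_le (hs.trans hsm.le)]
    exact Icc_subset_Icc_right hsm.le
  have hsub₂ : uIcc s (M.f m) ⊆ uIcc 0 (M.f m) := by
    rw [uIcc_of_le hsm.le, uIcc_of_le (hs.trans hsm.le)]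
    exact Icc_subset_Icc_left hs
  have hd := hi'.sub hi
  have h1 : 0 ≤ ∫ t in (0 : ℝ)..s, (M.levelValue D' t - M.levelValue D t) :=
    intervalIntegral.integral_nonneg hs fun t ht =>
      sub_nonneg.2 (hm.levelValue_le hD hD' hleft hright (ht.2.trans_lt hsm))
  have h2 : 0 < ∫ t in s..M.f m, (M.levelValue D' t - M.levelValue D t) :=
    intervalIntegral.intervalIntegral_pos_of_pos_on (hd.mono_set hsub₂)
      (fun t ht => sub_pos.2 (hlt t ht)) hsm
  have h3 := intervalIntegral.integral_add_adjacent_intervals (hd.mono_set hsub₁)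
    (hd.mono_set hsub₂)
  rw [intervalIntegral.integral_sub hi' hi] at h3
  rw [he, he']
  linarith

/-- For levels `t` just below `f m`, the right end `r` of the superlevel set lies strictly between
`m` and `a`, where the gain is strict: a point `b < a` with `f b < t` bounds `r` from above, and
continuity gives a point `d > m` with `f d > t`, which bounds it from below. -/
lemma UnimodalAt.menuValue_lt_right (hm : M.UnimodalAt m) (hD : M.IsMenu D) (hD' : M.IsMenu D')
    (hleft : ∀ θ ∈ Icc M.θlo m, M.env D' θ ≤ M.env D θ)
    (hright : ∀ θ ∈ Icc m M.θhi, M.env D θ ≤ M.env D' θ) {a : ℝ} (ha : a ∈ Icc m M.θhi)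
    (hfa : M.f a < M.f m) (hlt : ∀ θ ∈ Ioo m a, M.env D θ < M.env D' θ) :
    M.menuValue D < M.menuValue D' := by
  have hcont : ContinuousOn M.f (Icc m a) := M.f_cont.mono (Icc_subset_Icc hm.mem.1 ha.2)
  have hivt : ∀ u ∈ Ioo (M.f a) (M.f m), ∃ θ ∈ Ioo m a, M.f θ = u := fun u hu =>
    intermediate_value_Ioo' ha.1 hcont hu
  obtain ⟨s, hs⟩ := exists_between hfa
  obtain ⟨b, hb, hfb⟩ := hivt s hs
  have ha' : a ∈ Icc M.θlo M.θhi := ⟨hm.mem.1.trans ha.1, ha.2⟩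
  refine hm.menuValue_lt hD hD' hleft hright ((M.f_pos a ha').le.trans hs.1.le) hs.2 ?_
  intro t ht
  obtain ⟨l, hl, r, hr, h1, h2⟩ := hm.exists_superlevel ht.2
  rw [levelValue_eq hD hl.1 (hl.2.trans hr.1) hr.2 h1 h2,
    levelValue_eq hD' hl.1 (hl.2.trans hr.1) hr.2 h1 h2]
  have hrb : r ≤ b := by
    by_contra hc
    have := h1 b ⟨hl.2.trans_lt hb.1, not_le.1 hc⟩
    rw [hfb] at this
    exact lt_asymm this ht.1
  obtain ⟨u, hu⟩ := exists_between ht.2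
  obtain ⟨d, hd, hfd⟩ := hivt u ⟨hs.1.trans (ht.1.trans hu.1), hu.2⟩
  have hdr := h2 d ⟨hm.mem.1.trans hd.1.le, hd.2.le.trans ha.2⟩ (by rw [hfd]; exact hu.1)
  linarith [hleft l hl, hlt r ⟨hd.1.trans_le hdr.2, hrb.trans_lt hb.2⟩]

/-- Mirror image: here the left ends of the high superlevel sets fall strictly between `a` and `m`.
-/
lemma UnimodalAt.menuValue_lt_left (hm : M.UnimodalAt m) (hD : M.IsMenu D) (hD' : M.IsMenu D')
    (hleft : ∀ θ ∈ Icc M.θlo m, M.env D' θ ≤ M.env D θ)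
    (hright : ∀ θ ∈ Icc m M.θhi, M.env D θ ≤ M.env D' θ) {a : ℝ} (ha : a ∈ Icc M.θlo m)
    (hfa : M.f a < M.f m) (hlt : ∀ θ ∈ Ioo a m, M.env D' θ < M.env D θ) :
    M.menuValue D < M.menuValue D' := by
  have hcont : ContinuousOn M.f (Icc a m) := M.f_cont.mono (Icc_subset_Icc ha.1 hm.mem.2)
  have hivt : ∀ u ∈ Ioo (M.f a) (M.f m), ∃ θ ∈ Ioo a m, M.f θ = u := fun u hu =>
    intermediate_value_Ioo ha.2 hcont hu
  obtain ⟨s, hs⟩ := exists_between hfa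
  obtain ⟨b, hb, hfb⟩ := hivt s hs
  have ha' : a ∈ Icc M.θlo M.θhi := ⟨ha.1, ha.2.trans hm.mem.2⟩
  refine hm.menuValue_lt hD hD' hleft hright ((M.f_pos a ha').le.trans hs.1.le) hs.2 ?_
  intro t ht
  obtain ⟨l, hl, r, hr, h1, h2⟩ := hm.exists_superlevel ht.2
  rw [levelValue_eq hD hl.1 (hl.2.trans hr.1) hr.2 h1 h2,
    levelValue_eq hD' hl.1 (hl.2.trans hr.1) hr.2 h1 h2]
  have hlb : b ≤ l := by
    by_contra hc
    have := h1 b ⟨not_le.1 hc, hb.2.trans_le hr.1⟩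
    rw [hfb] at this
    exact lt_asymm this ht.1
  obtain ⟨u, hu⟩ := exists_between ht.2
  obtain ⟨d, hd, hfd⟩ := hivt u ⟨hs.1.trans (ht.1.trans hu.1), hu.2⟩
  have hdl := h2 d ⟨ha.1.trans hd.1.le, hd.2.le.trans hm.mem.2⟩ (by rw [hfd]; exact hu.1)
  linarith [hright r hr, hlt l ⟨hb.1.trans_le hlb, hdl.1.trans_lt hd.2⟩]

/-- The value of a menu is Lipschitz in its indirect utility. -/
lemma UnimodalAt.menuValue_le_add (hm : M.UnimodalAt m) (hD : M.IsMenu D) (hD' : M.IsMenu D')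
    {ε : ℝ} (h : ∀ θ ∈ Icc M.θlo M.θhi, |M.env D θ - M.env D' θ| ≤ ε) :
    M.menuValue D ≤ M.menuValue D' + M.f m * (2 * ε) := by
  obtain ⟨hi, he⟩ := hm.menuValue_eq hD
  obtain ⟨hi', he'⟩ := hm.menuValue_eq hD'
  have hconst : ∫ _ in (0 : ℝ)..M.f m, 2 * ε = M.f m * (2 * ε) := by
    rw [intervalIntegral.integral_const, sub_zero, smul_eq_mul]
  rw [he, he', ← hconst, ← intervalIntegral.integral_add hi' intervalIntegrable_const]
  refine intervalIntegral.integral_mono_on_of_le_Ioo (M.f_pos m hm.mem).le hi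
    (hi'.add intervalIntegrable_const) fun t ht => ?_
  obtain ⟨l, hl, r, hr, h1, h2⟩ := hm.exists_superlevel ht.2
  rw [levelValue_eq hD hl.1 (hl.2.trans hr.1) hr.2 h1 h2,
    levelValue_eq hD' hl.1 (hl.2.trans hr.1) hr.2 h1 h2]
  have hl' := abs_le.1 (h l ⟨hl.1, hl.2.trans hm.mem.2⟩)
  have hr' := abs_le.1 (h r ⟨hm.mem.1.trans hr.1, hr.2⟩)
  linarith [hl'.1, hr'.2]

end Comparison

/-! ### Lower censorship improves on every menu -/

lemma mem_Icc_zero {θ : ℝ} (h : θ ∈ Icc M.θlo M.θhi) : θ ∈ Icc 0 M.θhi :=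
  ⟨M.θlo_nonneg.trans h.1, h.2⟩

/-- Above a quality whose marginal cost exceeds the type, payoffs are decreasing. -/
lemma payoff_lt_of_le_marginalCost {θ x y : ℝ} (hx : x ∈ M.Q) (hy : y ∈ M.Q)
    (h : θ ≤ M.marginalCost x) (hxy : x < y) : θ * y - M.c y < θ * x - M.c x := by
  have := M.tangent_lt hx hy hxy.ne
  nlinarith [mul_le_mul_of_nonneg_right h (sub_nonneg.2 hxy.le)]

/-- For every menu, some lower censorship has the same indirect utility at `m`, a lower one below
`m`, and a higher one above `m`. -/
lemma IsMenu.exists_lowerMenu {D : Set ℝ} (hD : M.IsMenu D) {m : ℝ} (hm : m ∈ Icc M.θlo M.θhi) :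
    ∃ x ∈ M.Q, m ≤ M.marginalCost x ∧ M.cutoff x ≤ m ∧ m * x - M.c x = M.env D m ∧
      (∀ θ ∈ Icc M.θlo m, M.env (M.lowerMenu x) θ ≤ M.env D θ) ∧
      (∀ θ ∈ Icc m M.θhi, M.env D θ ≤ M.env (M.lowerMenu x) θ) := by
  obtain ⟨q₁, hq₁, h₁⟩ := M.exists_marginalCost_eq (mem_Icc_zero hm)
  -- The first best of `m` gives it at least `env D m`, so moving up from there brings its payoff
  -- down to exactly `env D m`.
  obtain ⟨x, hx, hqx, hval⟩ := M.exists_payoff_eq (mem_Icc_zero hm) hq₁ (hD.env_nonneg m)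
    (M.payoff_le_of_marginalCost_eq hq₁ (hD.sel_mem_Q m) h₁)
  have hmx : m ≤ M.marginalCost x := by
    rw [← h₁]
    exact M.marginalCost_strictMonoOn.monotoneOn hq₁ hx hqx
  have hL := isMenu_lowerMenu hx
  have hm0 : 0 ≤ m := M.θlo_nonneg.trans hm.1
  refine ⟨x, hx, hmx, ?_, hval, ?_, ?_⟩
  · rw [M.cutoff_le_iff hx hm0, hval]
    exact hD.env_nonneg m
  · intro θ hθ
    -- Slopes decide the comparison below `m`: `env D` lies above its tangent at `m` of slope `sel D
    -- m ≤ x`, hence above the payoff line of `x`, which meets it at `m`.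
    have hsx : M.sel D m ≤ x := by
      by_contra hc
      have := M.payoff_lt_of_le_marginalCost hx (hD.sel_mem_Q m) hmx (not_le.1 hc)
      rw [hval] at this
      exact lt_irrefl _ this
    rcases hL.sel_mem θ with h | h
    · have := hD.env_nonneg θ
      rwa [env, h, M.c_zero, mul_zero, sub_zero]
    · have h1 : M.env (M.lowerMenu x) θ ≤ θ * x - M.c x := by
        rcases h.1.eq_or_lt with h' | h'
        · rw [env, ← h']
        · exact (M.payoff_lt_of_le_marginalCost hx (hL.sel_mem_Q θ) (hθ.2.trans hmx) h').le
      have h2 := hD.env_ge m θ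
      nlinarith [mul_le_mul_of_nonneg_left hsx (sub_nonneg.2 hθ.2)]
  · intro θ hθ
    rcases le_total x (M.sel D θ) with h | h
    · exact hL.payoff_le_env θ (mem_lowerMenu (hD.sel_mem_Q θ) h)
    · have h1 := hD.payoff_le_env m (hD.sel_mem θ)
      have h2 := hL.payoff_le_env θ (mem_lowerMenu hx le_rfl)
      refine le_trans ?_ h2
      rw [env]
      nlinarith [mul_le_mul_of_nonneg_left h (sub_nonneg.2 hθ.1)]

/-- If the choice `z ≥ x` is forbidden by the standard `y`, the type can take `y` instead: the wage
rises, and the extra cost `c y - c z` is at most `c y - c x`. -/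
lemma env_lowerMenu_sub_le {x y θ : ℝ} (hx : x ∈ M.Q) (hy : y ∈ M.Q) (hθ : 0 ≤ θ) :
    M.env (M.lowerMenu x) θ - M.env (M.lowerMenu y) θ ≤ |M.c x - M.c y| := by
  have hX := isMenu_lowerMenu hx
  have hY := isMenu_lowerMenu hy
  set z := M.sel (M.lowerMenu x) θ with hz
  have habs := abs_nonneg (M.c x - M.c y)
  have henv : M.env (M.lowerMenu x) θ = θ * z - M.c z := rfl
  rcases hX.sel_mem θ with h | h
  · have h0 := hY.env_nonneg θ
    rw [henv, hz, h, M.c_zero]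
    linarith
  · rcases le_total y z with h' | h'
    · have := hY.payoff_le_env θ (mem_lowerMenu (hX.sel_mem_Q θ) h')
      linarith
    · have h1 := hY.payoff_le_env θ (mem_lowerMenu hy le_rfl)
      have h2 := M.c_strictMonoOn.monotoneOn hx (hX.sel_mem_Q θ) h.1
      have h3 := mul_le_mul_of_nonneg_left h' hθ
      have h4 := neg_abs_le (M.c x - M.c y)
      linarith

lemma UnimodalAt.continuousOn_menuValue {m : ℝ} (hm : M.UnimodalAt m) :
    ContinuousOn (fun x => M.menuValue (M.lowerMenu x)) M.Q := by
  have hle : ∀ x ∈ M.Q, ∀ y ∈ M.Q, M.menuValue (M.lowerMenu x) ≤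
      M.menuValue (M.lowerMenu y) + M.f m * (2 * |M.c x - M.c y|) := by
    intro x hx y hy
    refine hm.menuValue_le_add (isMenu_lowerMenu hx) (isMenu_lowerMenu hy) fun θ hθ => ?_
    have hθ0 := M.θlo_nonneg.trans hθ.1
    refine abs_sub_le_iff.2 ⟨env_lowerMenu_sub_le hx hy hθ0, ?_⟩
    rw [abs_sub_comm]
    exact env_lowerMenu_sub_le hy hx hθ0
  intro x hx
  rw [ContinuousWithinAt, tendsto_iff_dist_tendsto_zero]
  have hlim : Filter.Tendsto (fun y => M.f m * (2 * |M.c y - M.c x|)) (nhdsWithin x M.Q)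
      (nhds 0) := by
    have h1 : ContinuousWithinAt (fun y => M.f m * (2 * |M.c y - M.c x|)) M.Q x :=
      (((M.c_continuousOn x hx).sub continuousWithinAt_const).abs.const_mul 2).const_mul (M.f m)
    simpa [ContinuousWithinAt] using h1.tendsto
  refine squeeze_zero' (Filter.Eventually.of_forall fun _ => dist_nonneg) ?_ hlim
  filter_upwards [self_mem_nhdsWithin] with y hy
  rw [Real.dist_eq, abs_sub_le_iff]
  have h1 := hle x hx y hy
  have h2 := hle y hy x hx
  rw [abs_sub_comm] at h1
  exact ⟨by linarith, by linarith⟩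

/-- If the density peaks at `m`, some lower censorship with cutoff type near `m` is optimal. -/
lemma UnimodalAt.exists_isBestMenu {m : ℝ} (hm : M.UnimodalAt m) :
    ∃ x ∈ M.Q, m ≤ M.marginalCost x ∧ M.cutoff x ≤ m ∧ M.IsBestMenu (M.lowerMenu x) := by
  have hm0 : 0 ≤ m := M.θlo_nonneg.trans hm.mem.1
  -- `C` contains every standard that `IsMenu.exists_lowerMenu` produces, so a best one in `C` beats
  -- every menu.
  set C := {x ∈ M.Q | m ≤ M.marginalCost x ∧ M.cutoff x ≤ m} with hC
  have hCeq : C = (M.Q ∩ M.marginalCost ⁻¹' Ici m) ∩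
      (M.Q ∩ (fun x => m * x - M.c x) ⁻¹' Ici 0) := by
    ext x
    constructor
    · rintro ⟨h1, h2, h3⟩
      exact ⟨⟨h1, h2⟩, h1, (M.cutoff_le_iff h1 hm0).1 h3⟩
    · rintro ⟨⟨h1, h2⟩, -, h3⟩
      exact ⟨h1, h2, (M.cutoff_le_iff h1 hm0).2 h3⟩
  have hclosed : IsClosed C := by
    rw [hCeq]
    exact (M.marginalCost_continuousOn.preimage_isClosed_of_isClosed isClosed_Icc isClosed_Ici).inter
      (((continuousOn_const.mul continuousOn_id).sub
        M.c_continuousOn).preimage_isClosed_of_isClosed isClosed_Icc isClosed_Ici)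
  have hcomp : IsCompact C := M.isCompact_Q.of_isClosed_subset hclosed fun x hx => hx.1
  -- Full revelation is used here only to see that `C` is nonempty.
  obtain ⟨x₀, hx₀, h1, h2, -⟩ := (isMenu_lowerMenu M.zero_mem_Q).exists_lowerMenu hm.mem
  obtain ⟨x, hx, hmax⟩ := hcomp.exists_isMaxOn ⟨x₀, hx₀, h1, h2⟩
    (hm.continuousOn_menuValue.mono fun x hx => hx.1)
  refine ⟨x, hx.1, hx.2.1, hx.2.2, fun D hD => ?_⟩
  obtain ⟨y, hy, hy1, hy2, -, hl, hr⟩ := hD.exists_lowerMenu hm.mem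
  exact (hm.menuValue_le hD (isMenu_lowerMenu hy) hl hr).trans (hmax ⟨hy, hy1, hy2⟩)

/-! ### Pointwise comparisons of menus -/

lemma IsMenu.intervalIntegrable {D : Set ℝ} (hD : M.IsMenu D) {a b : ℝ}
    (ha : a ∈ Icc M.θlo M.θhi) (hb : b ∈ Icc M.θlo M.θhi) :
    IntervalIntegrable (fun θ => M.f θ * M.sel D θ) volume a b :=
  hD.monotone_sel.intervalIntegrable.continuousOn_mul
    (M.f_cont.mono (uIcc_subset_Icc ha hb))

lemma θlo_mem : M.θlo ∈ Icc M.θlo M.θhi := ⟨le_rfl, M.θlo_lt_θhi.le⟩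

lemma θhi_mem : M.θhi ∈ Icc M.θlo M.θhi := ⟨M.θlo_lt_θhi.le, le_rfl⟩

lemma menuValue_le_of_sel_le {D D' : Set ℝ} (hD : M.IsMenu D) (hD' : M.IsMenu D')
    (h : ∀ θ ∈ Ioo M.θlo M.θhi, M.sel D θ ≤ M.sel D' θ) : M.menuValue D ≤ M.menuValue D' :=
  intervalIntegral.integral_mono_on_of_le_Ioo M.θlo_lt_θhi.le
    (hD.intervalIntegrable θlo_mem θhi_mem) (hD'.intervalIntegrable θlo_mem θhi_mem)
    fun θ hθ => mul_le_mul_of_nonneg_left (h θ hθ) (M.f_pos θ ⟨hθ.1.le, hθ.2.le⟩).le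

lemma menuValue_lt_of_sel_lt {D D' : Set ℝ} (hD : M.IsMenu D) (hD' : M.IsMenu D') {b : ℝ}
    (hb : b ∈ Ioc M.θlo M.θhi) (h : ∀ θ ∈ Ioo M.θlo M.θhi, M.sel D θ ≤ M.sel D' θ)
    (hlt : ∀ θ ∈ Ioo M.θlo b, M.sel D θ < M.sel D' θ) : M.menuValue D < M.menuValue D' := by
  have hb' : b ∈ Icc M.θlo M.θhi := ⟨hb.1.le, hb.2⟩
  have h1 : ∫ θ in M.θlo..b, M.f θ * M.sel D θ < ∫ θ in M.θlo..b, M.f θ * M.sel D' θ := by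
    rw [← sub_pos, ← intervalIntegral.integral_sub (hD'.intervalIntegrable θlo_mem hb')
      (hD.intervalIntegrable θlo_mem hb')]
    refine intervalIntegral.intervalIntegral_pos_of_pos_on
      ((hD'.intervalIntegrable θlo_mem hb').sub (hD.intervalIntegrable θlo_mem hb')) ?_ hb.1
    intro θ hθ
    rw [← mul_sub]
    exact mul_pos (M.f_pos θ ⟨hθ.1.le, hθ.2.le.trans hb.2⟩) (sub_pos.2 (hlt θ hθ))
  have h2 : ∫ θ in b..M.θhi, M.f θ * M.sel D θ ≤ ∫ θ in b..M.θhi, M.f θ * M.sel D' θ :=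
    intervalIntegral.integral_mono_on_of_le_Ioo hb.2 (hD.intervalIntegrable hb' θhi_mem)
      (hD'.intervalIntegrable hb' θhi_mem) fun θ hθ => mul_le_mul_of_nonneg_left
        (h θ ⟨hb.1.trans hθ.1, hθ.2⟩) (M.f_pos θ ⟨(hb.1.trans hθ.1).le, hθ.2.le⟩).le
  rw [menuValue, menuValue, ← intervalIntegral.integral_add_adjacent_intervals
    (hD.intervalIntegrable θlo_mem hb') (hD.intervalIntegrable hb' θhi_mem),
    ← intervalIntegral.integral_add_adjacent_intervals
    (hD'.intervalIntegrable θlo_mem hb') (hD'.intervalIntegrable hb' θhi_mem)]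
  exact add_lt_add_of_lt_of_le h1 h2

/-- Types above the cutoff pass. -/
lemma le_sel_lowerMenu {x θ : ℝ} (hx : x ∈ M.Q) (hθ : 0 ≤ θ) (h : M.cutoff x ≤ θ) :
    x ≤ M.sel (M.lowerMenu x) θ := by
  have hL := isMenu_lowerMenu hx
  rcases hL.sel_mem θ with h0 | h0
  · refine hL.le_sel ⟨mem_lowerMenu hx le_rfl, fun y hy => ?_⟩
    refine (hL.payoff_le_env θ hy).trans ?_
    rw [env, h0, M.c_zero, mul_zero, sub_zero]
    exact (M.cutoff_le_iff hx hθ).1 h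
  · exact h0.1

lemma sel_lowerMenu_pos {x θ : ℝ} (hx : x ∈ M.Q) (hθ : 0 < θ) (hθ' : θ ≤ M.θhi)
    (h : M.cutoff x ≤ θ) : 0 < M.sel (M.lowerMenu x) θ := by
  rcases hx.1.eq_or_lt with rfl | hx0
  · have hL := isMenu_lowerMenu M.zero_mem_Q
    refine lt_of_le_of_ne (hL.sel_mem_Q θ).1 fun h0 => ?_
    obtain ⟨q, hq, hqθ⟩ := M.exists_marginalCost_eq ⟨hθ.le, hθ'⟩
    have h1 := (M.payoff_pos_of_marginalCost_eq hq hqθ hθ).2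
    have h2 := hL.payoff_le_env θ (mem_lowerMenu hq hq.1)
    rw [env, ← h0, M.c_zero, mul_zero, sub_zero] at h2
    exact absurd h1 (not_lt.2 h2)
  · exact hx0.trans_le (le_sel_lowerMenu hx hθ.le h)

/-- A choice below `x'` is pushed up to at least `x'`, as the type still passes; a choice above `x'`
remains available and optimal. -/
lemma sel_lowerMenu_le {x x' θ : ℝ} (hx : x ∈ M.Q) (hx' : x' ∈ M.Q) (hxx' : x ≤ x')
    (hθ : 0 ≤ θ) (h : M.cutoff x' ≤ θ) :
    M.sel (M.lowerMenu x) θ ≤ M.sel (M.lowerMenu x') θ := by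
  have hL := isMenu_lowerMenu hx
  have hL' := isMenu_lowerMenu hx'
  have hle := le_sel_lowerMenu hx' hθ h
  rcases le_total (M.sel (M.lowerMenu x) θ) x' with h1 | h1
  · exact h1.trans hle
  · refine hL'.le_sel ⟨mem_lowerMenu (hL.sel_mem_Q θ) h1, fun y hy => ?_⟩
    refine (hL'.payoff_le_env θ hy).trans ?_
    exact hL.payoff_le_env θ (mem_lowerMenu (hL'.sel_mem_Q θ) (hxx'.trans hle))

/-- Raising the standard without excluding types raises expected quality. -/
lemma menuValue_lowerMenu_le {x x' : ℝ} (hx : x ∈ M.Q) (hx' : x' ∈ M.Q) (hxx' : x ≤ x')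
    (h : M.cutoff x' ≤ M.θlo) : M.menuValue (M.lowerMenu x) ≤ M.menuValue (M.lowerMenu x') :=
  menuValue_le_of_sel_le (isMenu_lowerMenu hx) (isMenu_lowerMenu hx') fun _ hθ =>
    sel_lowerMenu_le hx hx' hxx' (M.θlo_nonneg.trans hθ.1.le) (h.trans hθ.1.le)

/-- A standard below the first best of the lowest type is not optimal. -/
lemma not_isBestMenu_of_marginalCost_lt {x : ℝ} (hx : x ∈ M.Q) (h : M.marginalCost x < M.θlo) :
    ¬ M.IsBestMenu (M.lowerMenu x) := by
  have hlo : 0 < M.θlo := (M.marginalCost_nonneg hx).trans_lt h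
  -- The standard `x'` makes `θlo` just willing to pass. Types slightly above `θlo` have their first
  -- best strictly between `x` and `x'` and are pushed up strictly.
  obtain ⟨x', hx', hcut⟩ := M.exists_cutoff_eq (mem_Icc_zero (M := M) θlo_mem)
  have hxx' : x < x' := by
    rw [← M.cutoff_strictMonoOn.lt_iff_lt hx hx', hcut]
    exact (M.cutoff_le_marginalCost hx).trans_lt h
  have hx'0 : 0 < x' := hx.1.trans_lt hxx'
  have hmc : M.θlo < M.marginalCost x' := by
    rw [← hcut, M.cutoff_lt_iff hx'0]
    have := M.tangent_lt hx' M.zero_mem_Q hx'0.ne'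
    rw [M.c_zero] at this
    linarith
  have hL := isMenu_lowerMenu hx
  have hL' := isMenu_lowerMenu hx'
  intro hbest
  refine not_lt.2 (hbest _ hL') (menuValue_lt_of_sel_lt hL hL'
    (b := min (M.marginalCost x') M.θhi) ⟨lt_min hmc M.θlo_lt_θhi, min_le_right _ _⟩ ?_ ?_)
  · intro θ hθ
    exact sel_lowerMenu_le hx hx' hxx'.le (hlo.le.trans hθ.1.le) (hcut.le.trans hθ.1.le)
  · intro θ hθ
    have hθhi : θ ≤ M.θhi := hθ.2.le.trans (min_le_right _ _)
    refine lt_of_lt_of_le ?_ (le_sel_lowerMenu hx' (hlo.le.trans hθ.1.le) (hcut.le.trans hθ.1.le))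
    obtain ⟨q, hq, hqθ⟩ := M.exists_marginalCost_eq (mem_Icc_zero (M := M) ⟨hθ.1.le, hθhi⟩)
    have hxq : x < q := M.lt_of_marginalCost_lt hx hq (by rw [hqθ]; exact h.trans hθ.1)
    have hqx' : q < x' := M.lt_of_marginalCost_lt hq hx'
      (by rw [hqθ]; exact hθ.2.trans_le (min_le_left _ _))
    have : q = M.sel (M.lowerMenu x) θ := by
      by_contra hne
      have h1 := M.payoff_lt_of_marginalCost_eq hq (hL.sel_mem_Q θ) hqθ hne
      exact absurd h1 (not_lt.2 (hL.payoff_le_env θ (mem_lowerMenu hq hxq.le)))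
    rwa [← this]

/-! ### Pass/fail tests -/

lemma menuValue_passMenu_le {x : ℝ} (hx : x ∈ M.Q) :
    M.menuValue (passMenu x) ≤ M.menuValue (M.lowerMenu x) := by
  have hP := isMenu_passMenu hx
  have hL := isMenu_lowerMenu hx
  refine menuValue_le_of_sel_le hP hL fun θ hθ => ?_
  have hθ0 : 0 ≤ θ := M.θlo_nonneg.trans hθ.1.le
  rcases hP.sel_mem θ with h | h
  · rw [h]
    exact (hL.sel_mem_Q θ).1
  · have h0 := hP.env_nonneg θ
    rw [env, mem_singleton_iff.1 h] at h0
    rw [mem_singleton_iff.1 h]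
    exact le_sel_lowerMenu hx hθ0 ((M.cutoff_le_iff hx hθ0).2 h0)

/-- No type has a first best above `x`, so every passing type chooses exactly `x`. -/
lemma menuValue_lowerMenu_le_passMenu {x : ℝ} (hx : x ∈ M.Q) (h : M.θhi ≤ M.marginalCost x) :
    M.menuValue (M.lowerMenu x) ≤ M.menuValue (passMenu x) := by
  have hP := isMenu_passMenu hx
  have hL := isMenu_lowerMenu hx
  refine menuValue_le_of_sel_le hL hP fun θ hθ => ?_
  rcases hL.sel_mem θ with h0 | h0
  · rw [h0]
    exact (hP.sel_mem_Q θ).1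
  · have hxsel : M.sel (M.lowerMenu x) θ = x := by
      refine le_antisymm ?_ h0.1
      by_contra hc
      have h1 := M.payoff_lt_of_le_marginalCost hx (hL.sel_mem_Q θ) (hθ.2.le.trans h) (not_le.1 hc)
      exact absurd h1 (not_lt.2 (hL.payoff_le_env θ (mem_lowerMenu hx le_rfl)))
    rw [hxsel]
    refine hP.le_sel ⟨Or.inr rfl, ?_⟩
    have hsub : passMenu x ⊆ M.lowerMenu x := by
      rintro y (rfl | rfl)
      · exact hL.zero_mem
      · exact mem_lowerMenu hx le_rfl
    intro y hy
    have := hL.payoff_le_env θ (hsub hy)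
    rwa [env, hxsel] at this

/-! ### Location of the optimal cutoff types -/

/-- If lower censorship is optimal, its cutoff type is near a mode. -/
lemma Unimodal.exists_mode_of_isBestMenu (h : M.Unimodal) {x : ℝ} (hx : x ∈ M.Q)
    (hbest : M.IsBestMenu (M.lowerMenu x)) :
    ∃ m, M.IsMode m ∧ M.cutoff x ≤ m ∧ m ≤ M.marginalCost x := by
  obtain ⟨m, hmem, h1, h2⟩ := h
  have hm : M.UnimodalAt m := ⟨hmem, h1, h2⟩
  have hL := isMenu_lowerMenu hx
  have hmode : ∀ a ∈ Icc M.θlo M.θhi, M.f m ≤ M.f a → M.IsMode a := fun a ha hfa =>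
    ⟨ha, fun θ hθ => (hm.le hθ).trans hfa⟩
  obtain ⟨y, hy, hmy, -, hval, hl, hr⟩ := hL.exists_lowerMenu hmem
  have hY := isMenu_lowerMenu hy
  rcases lt_or_ge m (M.cutoff x) with hlt | hge
  -- Here the cutoff itself is a mode. Types between `m` and the cutoff get utility `0` under `x`
  -- but a positive one under `y`, so `f (cutoff x) < f m` would make `y` strictly better.
  · have hcut : M.cutoff x ∈ Icc m M.θhi := ⟨hlt.le, (M.cutoff_mem hx).2⟩
    have hx0 : 0 < x := by
      refine lt_of_le_of_ne hx.1 fun h0 => ?_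
      rw [← h0, M.cutoff_zero] at hlt
      exact absurd hlt (not_lt.2 (M.θlo_nonneg.trans hmem.1))
    refine ⟨M.cutoff x, hmode _ ⟨hmem.1.trans hlt.le, hcut.2⟩ ?_, le_rfl,
      M.cutoff_le_marginalCost hx⟩
    by_contra hc
    refine not_lt.2 (hbest _ hY) (hm.menuValue_lt_right hL hY hl hr hcut (not_le.1 hc) ?_)
    intro θ hθ
    have hzero : ∀ s < M.cutoff x, M.env (M.lowerMenu x) s = 0 := by
      intro s hs
      refine le_antisymm ?_ (hL.env_nonneg s)
      rcases hL.sel_mem s with h0 | h0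
      · rw [env, h0, M.c_zero, mul_zero, sub_zero]
      · have h3 := M.cutoff_strictMonoOn.monotoneOn hx (hL.sel_mem_Q s) h0.1
        by_contra hc'
        have h4 := (M.cutoff_lt_iff (hx0.trans_le h0.1)).2 (not_le.1 hc')
        linarith
    rw [hzero θ hθ.2]
    rw [hzero m hlt] at hval
    have hymc : M.cutoff y ≤ m := (M.cutoff_le_iff hy (M.θlo_nonneg.trans hmem.1)).2 hval.ge
    -- Under `y` the midpoint type chooses a positive quality, which is a positive slope of the
    -- nonnegative indirect utility and makes it positive at `θ`.
    have hmid : m < (m + θ) / 2 := by linarith [hθ.1]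
    have hmid' : (m + θ) / 2 < θ := by linarith [hθ.1]
    have hpos := sel_lowerMenu_pos hy ((M.θlo_nonneg.trans hmem.1).trans_lt hmid)
      ((hmid'.trans hθ.2).le.trans hcut.2) (hymc.trans hmid.le)
    linarith [mul_pos hpos (sub_pos.2 hmid'), hY.env_nonneg ((m + θ) / 2),
      hY.env_ge ((m + θ) / 2) θ]
  · rcases lt_or_ge (M.marginalCost x) m with hlt' | hge'
    -- Here `marginalCost x` is a mode. The standard `x` leaves `m` its first best `q₁`, so `y =
    -- q₁`; types between `marginalCost x` and `m` get their first best under `x`, but not under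
    -- `y`.
    · obtain ⟨q₁, hq₁, hq₁m⟩ := M.exists_marginalCost_eq (mem_Icc_zero hmem)
      have hxq : x < q₁ := M.lt_of_marginalCost_lt hx hq₁ (by rwa [hq₁m])
      have hyq : y = q₁ := by
        by_contra hne
        have h3 := M.payoff_lt_of_marginalCost_eq hq₁ hy hq₁m (Ne.symm hne)
        rw [hval] at h3
        exact absurd h3 (not_lt.2 (hL.payoff_le_env m (mem_lowerMenu hq₁ hxq.le)))
      have hlo : M.θlo ≤ M.marginalCost x := by
        by_contra hc
        exact not_isBestMenu_of_marginalCost_lt hx (not_le.1 hc) hbest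
      have hf : M.f m ≤ M.f (M.marginalCost x) := by
        by_contra hc
        refine not_lt.2 (hbest _ hY)
          (hm.menuValue_lt_left hL hY hl hr ⟨hlo, hlt'.le⟩ (not_le.1 hc) ?_)
        intro θ hθ
        have hθ0 : 0 < θ := (M.marginalCost_nonneg hx).trans_lt hθ.1
        obtain ⟨q, hq, hqθ⟩ := M.exists_marginalCost_eq (θ := θ) ⟨hθ0.le, hθ.2.le.trans hmem.2⟩
        have hxq' : x < q := M.lt_of_marginalCost_lt hx hq (by rw [hqθ]; exact hθ.1)
        have hqq : q < q₁ := M.lt_of_marginalCost_lt hq hq₁ (by rw [hqθ, hq₁m]; exact hθ.2)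
        refine lt_of_lt_of_le ?_ (hL.payoff_le_env θ (mem_lowerMenu hq hxq'.le))
        refine M.payoff_lt_of_marginalCost_eq hq (hY.sel_mem_Q θ) hqθ ?_
        rcases hY.sel_mem θ with h0 | h0
        · rw [h0]
          exact (M.payoff_pos_of_marginalCost_eq hq hqθ hθ0).1.ne'
        · exact (hqq.trans_le (hyq ▸ h0.1)).ne
      exact ⟨M.marginalCost x, hmode _ ⟨hlo, hlt'.le.trans hmem.2⟩ hf,
        M.cutoff_le_marginalCost hx, le_rfl⟩
    · exact ⟨m, hm.isMode, hge, hge'⟩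

/-! ### Removing a gap from full revelation -/

lemma IsMenu.sel_marginalCost {D : Set ℝ} (hD : M.IsMenu D) {q : ℝ} (hq : q ∈ D) :
    M.sel D (M.marginalCost q) = q := by
  by_contra hne
  have h1 := M.payoff_lt_of_marginalCost_eq (hD.subset hq) (hD.sel_mem_Q _) rfl (Ne.symm hne)
  exact absurd h1 (not_lt.2 (hD.payoff_le_env _ hq))

/-- All qualities outside of a gap. -/
def gapMenu (M : RatingModel) (y₁ y₂ : ℝ) : Set ℝ := Icc 0 y₁ ∪ Icc y₂ M.qmax

section Gap

variable {y₁ y₂ t l : ℝ}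

lemma isMenu_gapMenu (h₁ : y₁ ∈ M.Q) (h₂ : y₂ ∈ M.Q) : M.IsMenu (M.gapMenu y₁ y₂) where
  compact := isCompact_Icc.union isCompact_Icc
  zero_mem := Or.inl ⟨le_rfl, h₁.1⟩
  subset := by
    rintro y (hy | hy)
    · exact ⟨hy.1, hy.2.trans h₁.2⟩
    · exact ⟨h₂.1.trans hy.1, hy.2⟩

/-- For these types the payoff increases up to `y₁` and decreases from `y₂` on, so only the ends of
the gap compete. -/
lemma sel_gapMenu_eq_or (h₁ : y₁ ∈ M.Q) (h₂ : y₂ ∈ M.Q) {θ : ℝ} (hθ₁ : M.marginalCost y₁ ≤ θ)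
    (hθ₂ : θ ≤ M.marginalCost y₂) :
    M.sel (M.gapMenu y₁ y₂) θ = y₁ ∨ M.sel (M.gapMenu y₁ y₂) θ = y₂ := by
  have hG := isMenu_gapMenu h₁ h₂
  rcases hG.sel_mem θ with h | h
  · left
    refine le_antisymm h.2 ?_
    by_contra hc
    push Not at hc
    have h3 := M.tangent_lt h₁ (hG.sel_mem_Q θ) hc.ne'
    have h4 := hG.payoff_le_env θ (y := y₁) (Or.inl ⟨h₁.1, le_rfl⟩)
    rw [env] at h4
    nlinarith [mul_nonneg (sub_nonneg.2 hθ₁) (sub_nonneg.2 hc.le)]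
  · right
    refine le_antisymm ?_ h.1
    by_contra hc
    have h3 := M.payoff_lt_of_le_marginalCost h₂ (hG.sel_mem_Q θ) hθ₂ (not_le.1 hc)
    exact absurd h3 (not_lt.2 (hG.payoff_le_env θ (Or.inr ⟨le_rfl, h₂.2⟩)))

lemma sel_gapMenu_of_lt (h₁ : y₁ ∈ M.Q) (h₂ : y₂ ∈ M.Q) (h : y₁ < y₂)
    (ht : t * (y₂ - y₁) = M.c y₂ - M.c y₁) {θ : ℝ} (hθ₁ : M.marginalCost y₁ ≤ θ)
    (hθ₂ : θ ≤ M.marginalCost y₂) (hθ : θ < t) : M.sel (M.gapMenu y₁ y₂) θ = y₁ := by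
  have hG := isMenu_gapMenu h₁ h₂
  refine (sel_gapMenu_eq_or h₁ h₂ hθ₁ hθ₂).resolve_right fun hs => ?_
  have h3 := hG.payoff_le_env θ (y := y₁) (Or.inl ⟨h₁.1, le_rfl⟩)
  rw [env, hs] at h3
  nlinarith [mul_pos (sub_pos.2 hθ) (sub_pos.2 h)]

lemma sel_gapMenu_of_gt (h₁ : y₁ ∈ M.Q) (h₂ : y₂ ∈ M.Q) (h : y₁ < y₂)
    (ht : t * (y₂ - y₁) = M.c y₂ - M.c y₁) {θ : ℝ} (hθ₁ : M.marginalCost y₁ ≤ θ)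
    (hθ₂ : θ ≤ M.marginalCost y₂) (hθ : t < θ) : M.sel (M.gapMenu y₁ y₂) θ = y₂ := by
  have hG := isMenu_gapMenu h₁ h₂
  refine (sel_gapMenu_eq_or h₁ h₂ hθ₁ hθ₂).resolve_left fun hs => ?_
  have h3 := hG.payoff_le_env θ (y := y₂) (Or.inr ⟨le_rfl, h₂.2⟩)
  rw [env, hs] at h3
  nlinarith [mul_pos (sub_pos.2 hθ) (sub_pos.2 h)]

/-- The type `t` indifferent between the ends of the gap is the slope of their chord. -/
lemma chord_mem (h₁ : y₁ ∈ M.Q) (h₂ : y₂ ∈ M.Q) (h : y₁ < y₂)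
    (ht : t * (y₂ - y₁) = M.c y₂ - M.c y₁) :
    M.marginalCost y₁ < t ∧ t < M.marginalCost y₂ := by
  have h3 := M.tangent_lt h₁ h₂ h.ne
  have h4 := M.tangent_lt h₂ h₁ h.ne'
  constructor
  · by_contra hc
    nlinarith [mul_nonneg (sub_nonneg.2 (not_lt.1 hc)) (sub_nonneg.2 h.le)]
  · by_contra hc
    nlinarith [mul_nonneg (sub_nonneg.2 (not_lt.1 hc)) (sub_nonneg.2 h.le)]

lemma isMenu_full : M.IsMenu (M.lowerMenu 0) := isMenu_lowerMenu M.zero_mem_Q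

lemma sel_full {q : ℝ} (hq : q ∈ M.Q) : M.sel (M.lowerMenu 0) (M.marginalCost q) = q :=
  isMenu_full.sel_marginalCost (mem_lowerMenu hq hq.1)

/-- Outside of the gap, choices are those under full revelation. -/
lemma sel_gapMenu_eq_full (h₁ : y₁ ∈ M.Q) (h₂ : y₂ ∈ M.Q) {θ : ℝ} (hθ : θ ∈ Icc 0 M.θhi)
    (h : θ ≤ M.marginalCost y₁ ∨ M.marginalCost y₂ ≤ θ) :
    M.sel (M.gapMenu y₁ y₂) θ = M.sel (M.lowerMenu 0) θ := by
  obtain ⟨q, hq, rfl⟩ := M.exists_marginalCost_eq hθ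
  rw [sel_full hq, (isMenu_gapMenu h₁ h₂).sel_marginalCost]
  rcases h with h | h
  · exact Or.inl ⟨hq.1, M.le_of_marginalCost_le hq h₁ h⟩
  · exact Or.inr ⟨M.le_of_marginalCost_le h₂ hq h, hq.2⟩

/-- The integral of the first-best qualities in the gap, by layers of quality. -/
lemma integral_full_mul (h₁ : y₁ ∈ M.Q) (h₂ : y₂ ∈ M.Q) (h : y₁ < y₂)
    (hhi : M.marginalCost y₂ ≤ M.θhi) {k : ℝ → ℝ}
    (hk : ContinuousOn k (Icc (M.marginalCost y₁) (M.marginalCost y₂))) :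
    ∫ θ in M.marginalCost y₁..M.marginalCost y₂, (M.sel (M.lowerMenu 0) θ - y₁) * k θ =
      ∫ y in y₁..y₂, ∫ θ in M.marginalCost y..M.marginalCost y₂, k θ := by
  have hθ : M.marginalCost y₁ < M.marginalCost y₂ := M.marginalCost_strictMonoOn h₁ h₂ h
  have hsel : ∀ θ ∈ Icc (M.marginalCost y₁) (M.marginalCost y₂),
      ∃ q ∈ Icc y₁ y₂, M.marginalCost q = θ ∧ M.sel (M.lowerMenu 0) θ = q := by
    intro θ hθ
    obtain ⟨q, hq, rfl⟩ := M.exists_marginalCost_eq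
      ⟨(M.marginalCost_nonneg h₁).trans hθ.1, hθ.2.trans hhi⟩
    exact ⟨q, ⟨M.le_of_marginalCost_le h₁ hq hθ.1, M.le_of_marginalCost_le hq h₂ hθ.2⟩, rfl,
      sel_full hq⟩
  rw [intervalIntegral.integral_of_le hθ.le, ← integral_Icc_eq_integral_Ioc,
    (integral_mul_eq_integral_superlevel (K := y₂ - y₁) (sub_nonneg.2 h.le) ?_ ?_ ?_).2]
  · have hsub := intervalIntegral.integral_comp_add_left (a := 0) (b := y₂ - y₁)
      (fun y => ∫ θ in M.marginalCost y..M.marginalCost y₂, k θ) y₁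
    rw [add_zero, add_sub_cancel] at hsub
    rw [← hsub]
    refine intervalIntegral.integral_congr fun y hy => ?_
    rw [uIcc_of_le (sub_nonneg.2 h.le)] at hy
    have hyQ : y₁ + y ∈ M.Q := ⟨by linarith [hy.1, h₁.1], by linarith [hy.2, h₂.2]⟩
    have hle₁ : M.marginalCost y₁ ≤ M.marginalCost (y₁ + y) :=
      M.marginalCost_strictMonoOn.monotoneOn h₁ hyQ (by linarith [hy.1])
    have hle₂ : M.marginalCost (y₁ + y) ≤ M.marginalCost y₂ :=
      M.marginalCost_strictMonoOn.monotoneOn hyQ h₂ (by linarith [hy.2])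
    have hinter : Ioc (M.marginalCost (y₁ + y)) (M.marginalCost y₂) ∩
        Icc (M.marginalCost y₁) (M.marginalCost y₂) =
        Ioc (M.marginalCost (y₁ + y)) (M.marginalCost y₂) :=
      inter_eq_left.2 fun θ hθ => ⟨hle₁.trans hθ.1.le, hθ.2⟩
    have hcongr : ∫ θ in Icc (M.marginalCost y₁) (M.marginalCost y₂),
        (if y < M.sel (M.lowerMenu 0) θ - y₁ then k θ else 0) =
        ∫ θ in Icc (M.marginalCost y₁) (M.marginalCost y₂),
          (Ioc (M.marginalCost (y₁ + y)) (M.marginalCost y₂)).indicator k θ := by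
      refine setIntegral_congr_fun measurableSet_Icc fun θ hθ => ?_
      obtain ⟨q, hq, hqθ, hs⟩ := hsel θ hθ
      have hqQ : q ∈ M.Q := ⟨h₁.1.trans hq.1, hq.2.trans h₂.2⟩
      -- Marginal cost is increasing, so the layer at quality `y₁ + y` consists of the types above
      -- `marginalCost (y₁ + y)`.
      have hiff : y < q - y₁ ↔ M.marginalCost (y₁ + y) < θ := by
        rw [← hqθ, M.marginalCost_strictMonoOn.lt_iff_lt hyQ hqQ, lt_sub_iff_add_lt']
      simp only [hs, hiff, indicator, mem_Ioc, hθ.2, and_true]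
    rw [hcongr, integral_indicator measurableSet_Ioc, Measure.restrict_restrict measurableSet_Ioc,
      hinter, ← intervalIntegral.integral_of_le hle₂]
  · exact (isMenu_full.monotone_sel.measurable.sub_const _).aemeasurable
  · filter_upwards [ae_restrict_mem measurableSet_Icc] with θ hθ
    obtain ⟨q, hq, -, hs⟩ := hsel θ hθ
    rw [hs]
    exact ⟨sub_nonneg.2 hq.1, by linarith [hq.2]⟩
  · exact hk.integrableOn_Icc

lemma marginalCost_mem_Icc (h₁ : y₁ ∈ M.Q) (h₂ : y₂ ∈ M.Q) {y : ℝ} (hy : y ∈ Icc y₁ y₂) :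
    M.marginalCost y ∈ Icc (M.marginalCost y₁) (M.marginalCost y₂) := by
  have hyQ : y ∈ M.Q := ⟨h₁.1.trans hy.1, hy.2.trans h₂.2⟩
  exact ⟨M.marginalCost_strictMonoOn.monotoneOn h₁ hyQ hy.1,
    M.marginalCost_strictMonoOn.monotoneOn hyQ h₂ hy.2⟩

lemma marginalCost_mem (h₁ : y₁ ∈ M.Q) (h₂ : y₂ ∈ M.Q) (hlo : M.θlo ≤ M.marginalCost y₁)
    (hhi : M.marginalCost y₂ ≤ M.θhi) {y : ℝ} (hy : y ∈ Icc y₁ y₂) :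
    M.marginalCost y ∈ Icc M.θlo M.θhi :=
  Icc_subset_Icc hlo hhi (marginalCost_mem_Icc h₁ h₂ hy)

lemma continuousOn_primitive {a : ℝ} (ha : a ∈ Icc M.θlo M.θhi) :
    ContinuousOn (fun b => ∫ θ in a..b, (M.f θ - l)) (Icc M.θlo M.θhi) := by
  have hk : ContinuousOn (fun θ => M.f θ - l) (uIcc M.θlo M.θhi) := by
    rw [uIcc_of_le M.θlo_lt_θhi.le]
    exact M.f_cont.sub continuousOn_const
  have := intervalIntegral.continuousOn_primitive_interval' (a := a) (μ := volume)
    hk.intervalIntegrable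
    (by rwa [uIcc_of_le M.θlo_lt_θhi.le])
  rwa [uIcc_of_le M.θlo_lt_θhi.le] at this

lemma continuousOn_integral_marginalCost (h₁ : y₁ ∈ M.Q) (h₂ : y₂ ∈ M.Q)
    (hlo : M.θlo ≤ M.marginalCost y₁) (hhi : M.marginalCost y₂ ≤ M.θhi) {a : ℝ}
    (ha : a ∈ Icc M.θlo M.θhi) :
    ContinuousOn (fun y => ∫ θ in a..M.marginalCost y, (M.f θ - l)) (Icc y₁ y₂) :=
  (continuousOn_primitive ha).comp (M.marginalCost_continuousOn.mono (Icc_subset_Icc h₁.1 h₂.2))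
    fun _ hy => marginalCost_mem h₁ h₂ hlo hhi hy

/-- The change of expected quality when a gap is removed from full revelation. -/
lemma menuValue_gapMenu_sub (h₁ : y₁ ∈ M.Q) (h₂ : y₂ ∈ M.Q) (h : y₁ < y₂)
    (ht : t * (y₂ - y₁) = M.c y₂ - M.c y₁) (hlo : M.θlo ≤ M.marginalCost y₁)
    (hhi : M.marginalCost y₂ ≤ M.θhi) :
    M.menuValue (M.gapMenu y₁ y₂) - M.menuValue (M.lowerMenu 0) =
      ∫ y in y₁..y₂, ∫ θ in t..M.marginalCost y, (M.f θ - l) := by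
  have hG := isMenu_gapMenu h₁ h₂
  have hE := isMenu_full (M := M)
  obtain ⟨ht₁, ht₂⟩ := chord_mem h₁ h₂ h ht
  set θ₁ := M.marginalCost y₁ with hθ₁
  set θ₂ := M.marginalCost y₂ with hθ₂
  have hm₁ : θ₁ ∈ Icc M.θlo M.θhi := ⟨hlo, (ht₁.trans ht₂).le.trans hhi⟩
  have hm₂ : θ₂ ∈ Icc M.θlo M.θhi := ⟨hlo.trans (ht₁.trans ht₂).le, hhi⟩
  have hmt : t ∈ Icc M.θlo M.θhi := ⟨hlo.trans ht₁.le, ht₂.le.trans hhi⟩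
  have hk : ContinuousOn (fun θ => M.f θ - l) (Icc M.θlo M.θhi) := M.f_cont.sub continuousOn_const
  have hki : ∀ a ∈ Icc M.θlo M.θhi, ∀ b ∈ Icc M.θlo M.θhi,
      IntervalIntegrable (fun θ => M.f θ - l) volume a b := fun a ha b hb =>
    (hk.mono (uIcc_subset_Icc ha hb)).intervalIntegrable
  have hdi : ∀ a ∈ Icc M.θlo M.θhi, ∀ b ∈ Icc M.θlo M.θhi, IntervalIntegrable
      (fun θ => M.f θ * M.sel (M.gapMenu y₁ y₂) θ - M.f θ * M.sel (M.lowerMenu 0) θ) volume a b :=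
    fun a ha b hb => (hG.intervalIntegrable ha hb).sub (hE.intervalIntegrable ha hb)
  have hmid : M.menuValue (M.gapMenu y₁ y₂) - M.menuValue (M.lowerMenu 0) =
      ∫ θ in θ₁..θ₂, (M.f θ * M.sel (M.gapMenu y₁ y₂) θ - M.f θ * M.sel (M.lowerMenu 0) θ) := by
    rw [menuValue, menuValue, ← intervalIntegral.integral_sub
      (hG.intervalIntegrable θlo_mem θhi_mem) (hE.intervalIntegrable θlo_mem θhi_mem),
      ← intervalIntegral.integral_add_adjacent_intervals (hdi _ θlo_mem _ hm₁)
        (hdi _ hm₁ _ θhi_mem),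
      ← intervalIntegral.integral_add_adjacent_intervals (hdi _ hm₁ _ hm₂) (hdi _ hm₂ _ θhi_mem)]
    have z₁ : ∫ θ in M.θlo..θ₁, (M.f θ * M.sel (M.gapMenu y₁ y₂) θ -
        M.f θ * M.sel (M.lowerMenu 0) θ) = 0 := by
      refine (intervalIntegral.integral_congr (g := fun _ => 0) fun θ hθ => ?_).trans
        intervalIntegral.integral_zero
      rw [uIcc_of_le hm₁.1] at hθ
      rw [sel_gapMenu_eq_full h₁ h₂ (mem_Icc_zero ⟨hθ.1, hθ.2.trans hm₁.2⟩) (Or.inl hθ.2), sub_self]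
    have z₂ : ∫ θ in θ₂..M.θhi, (M.f θ * M.sel (M.gapMenu y₁ y₂) θ -
        M.f θ * M.sel (M.lowerMenu 0) θ) = 0 := by
      refine (intervalIntegral.integral_congr (g := fun _ => 0) fun θ hθ => ?_).trans
        intervalIntegral.integral_zero
      rw [uIcc_of_le hm₂.2] at hθ
      rw [sel_gapMenu_eq_full h₁ h₂ (mem_Icc_zero ⟨hm₂.1.trans hθ.1, hθ.2⟩) (Or.inr hθ.1), sub_self]
    rw [z₁, z₂, zero_add, add_zero]
  have henv : ∀ θ ∈ Icc M.θlo M.θhi, (θ ≤ θ₁ ∨ θ₂ ≤ θ) →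
      M.env (M.gapMenu y₁ y₂) θ = M.env (M.lowerMenu 0) θ := fun θ hθ h' => by
    rw [env, env, sel_gapMenu_eq_full h₁ h₂ (mem_Icc_zero hθ) h']
  -- The gap does not change indirect utility at `θ₁` and `θ₂`, so the unweighted integral of
  -- choices is unchanged and any constant `l` may be subtracted from the density.
  have hsame : ∫ θ in θ₁..θ₂, M.sel (M.gapMenu y₁ y₂) θ =
      ∫ θ in θ₁..θ₂, M.sel (M.lowerMenu 0) θ := by
    rw [hG.integral_sel, hE.integral_sel, henv _ hm₁ (Or.inl le_rfl), henv _ hm₂ (Or.inr le_rfl)]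
  have hGi : ∀ a b, IntervalIntegrable (M.sel (M.gapMenu y₁ y₂)) volume a b :=
    fun a b => hG.monotone_sel.intervalIntegrable
  have hEi : ∀ a b, IntervalIntegrable (M.sel (M.lowerMenu 0)) volume a b :=
    fun a b => hE.monotone_sel.intervalIntegrable
  have hGk : ∀ a ∈ Icc M.θlo M.θhi, ∀ b ∈ Icc M.θlo M.θhi, IntervalIntegrable
      (fun θ => (M.sel (M.gapMenu y₁ y₂) θ - y₁) * (M.f θ - l)) volume a b := fun a ha b hb =>
    ((hGi a b).sub intervalIntegrable_const).mul_continuousOn (hk.mono (uIcc_subset_Icc ha hb))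
  have hEk : IntervalIntegrable
      (fun θ => (M.sel (M.lowerMenu 0) θ - y₁) * (M.f θ - l)) volume θ₁ θ₂ :=
    ((hEi _ _).sub intervalIntegrable_const).mul_continuousOn (hk.mono (uIcc_subset_Icc hm₁ hm₂))
  have hcenter : M.menuValue (M.gapMenu y₁ y₂) - M.menuValue (M.lowerMenu 0) =
      (∫ θ in θ₁..θ₂, (M.sel (M.gapMenu y₁ y₂) θ - y₁) * (M.f θ - l)) -
        ∫ θ in θ₁..θ₂, (M.sel (M.lowerMenu 0) θ - y₁) * (M.f θ - l) := by
    have hzero : ∫ θ in θ₁..θ₂, l * (M.sel (M.gapMenu y₁ y₂) θ - M.sel (M.lowerMenu 0) θ) = 0 := by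
      rw [intervalIntegral.integral_const_mul, intervalIntegral.integral_sub (hGi _ _) (hEi _ _),
        hsame, sub_self, mul_zero]
    rw [hmid, ← intervalIntegral.integral_sub (hGk _ hm₁ _ hm₂) hEk]
    refine (sub_eq_self.2 hzero).symm.trans ?_
    rw [← intervalIntegral.integral_sub (hdi _ hm₁ _ hm₂) (((hGi _ _).sub (hEi _ _)).const_mul l)]
    refine intervalIntegral.integral_congr fun θ _ => ?_
    ring
  -- With the gap, the choice jumps from `y₁` to `y₂` at `t`.
  have hgap : ∫ θ in θ₁..θ₂, (M.sel (M.gapMenu y₁ y₂) θ - y₁) * (M.f θ - l) =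
      ∫ y in y₁..y₂, ∫ θ in t..θ₂, (M.f θ - l) := by
    rw [← intervalIntegral.integral_add_adjacent_intervals (hGk _ hm₁ _ hmt) (hGk _ hmt _ hm₂),
      intervalIntegral.integral_const, smul_eq_mul, ← intervalIntegral.integral_const_mul]
    have z₁ : ∫ θ in θ₁..t, (M.sel (M.gapMenu y₁ y₂) θ - y₁) * (M.f θ - l) = 0 := by
      refine (intervalIntegral.integral_congr_Ioo_of_le (g := fun _ => 0) ht₁.le
        fun θ hθ => ?_).trans intervalIntegral.integral_zero
      rw [sel_gapMenu_of_lt h₁ h₂ h ht hθ.1.le (hθ.2.le.trans ht₂.le) hθ.2, sub_self, zero_mul]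
    rw [z₁, zero_add]
    refine intervalIntegral.integral_congr_Ioo_of_le ht₂.le fun θ hθ => ?_
    rw [sel_gapMenu_of_gt h₁ h₂ h ht (ht₁.le.trans hθ.1.le) hθ.2.le hθ.1]
  have hmem : ∀ y ∈ Icc y₁ y₂, M.marginalCost y ∈ Icc M.θlo M.θhi :=
    fun y hy => marginalCost_mem h₁ h₂ hlo hhi hy
  have hprim : ContinuousOn (fun y => ∫ θ in M.marginalCost y..θ₂, (M.f θ - l)) (uIcc y₁ y₂) := by
    rw [uIcc_of_le h.le]
    simp only [intervalIntegral.integral_symm θ₂]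
    exact (continuousOn_integral_marginalCost h₁ h₂ hlo hhi hm₂).neg
  rw [hcenter, hgap, integral_full_mul h₁ h₂ h hhi (hk.mono (Icc_subset_Icc hlo hhi)),
    ← intervalIntegral.integral_sub intervalIntegrable_const hprim.intervalIntegrable]
  refine intervalIntegral.integral_congr fun y hy => ?_
  rw [uIcc_of_le h.le] at hy
  rw [← intervalIntegral.integral_add_adjacent_intervals (hki _ hmt _ (hmem y hy))
    (hki _ (hmem y hy) _ hm₂), add_sub_cancel_right]

/-- Under full revelation, a gap is profitable if the distribution function lies above one of its
tangents on the corresponding interval of types. -/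
lemma not_isBestMenu_of_gap (h₁ : y₁ ∈ M.Q) (h₂ : y₂ ∈ M.Q) (h : y₁ < y₂)
    (ht : t * (y₂ - y₁) = M.c y₂ - M.c y₁) (hlo : M.θlo ≤ M.marginalCost y₁)
    (hhi : M.marginalCost y₂ ≤ M.θhi)
    (hmin : ∀ s ∈ Icc (M.marginalCost y₁) (M.marginalCost y₂), 0 ≤ ∫ θ in t..s, (M.f θ - l))
    (hpos : ∃ y ∈ Icc y₁ y₂, 0 < ∫ θ in t..M.marginalCost y, (M.f θ - l)) :
    ¬ M.IsBestMenu (M.lowerMenu 0) := by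
  intro hbest
  obtain ⟨ht₁, ht₂⟩ := chord_mem h₁ h₂ h ht
  have hmt : t ∈ Icc M.θlo M.θhi := ⟨hlo.trans ht₁.le, ht₂.le.trans hhi⟩
  have hint : 0 < ∫ y in y₁..y₂, ∫ θ in t..M.marginalCost y, (M.f θ - l) := by
    refine intervalIntegral.integral_pos h
      (continuousOn_integral_marginalCost h₁ h₂ hlo hhi hmt) (fun y hy => hmin _ ?_) hpos
    exact marginalCost_mem_Icc h₁ h₂ ⟨hy.1.le, hy.2⟩
  rw [← menuValue_gapMenu_sub h₁ h₂ h ht hlo hhi] at hint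
  linarith [hbest _ (isMenu_gapMenu h₁ h₂)]

end Gap

/-- If the density is not decreasing, its integral against some constant has a strict interior
minimum. -/
lemma exists_tangent_of_lt {a b : ℝ} (ha : a ∈ Icc M.θlo M.θhi) (hb : b ∈ Icc M.θlo M.θhi)
    (hab : a < b) (hf : M.f a < M.f b) :
    ∃ l, ∃ t ∈ Ioo a b, (∀ s ∈ Icc a b, 0 ≤ ∫ θ in t..s, (M.f θ - l)) ∧
      0 < ∫ θ in t..a, (M.f θ - l) ∧ 0 < ∫ θ in t..b, (M.f θ - l) := by
  obtain ⟨l, hl₁, hl₂⟩ := exists_between hf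
  have hsub : Icc a b ⊆ Icc M.θlo M.θhi := Icc_subset_Icc ha.1 hb.2
  have hfc : ContinuousOn M.f (Icc a b) := M.f_cont.mono hsub
  have hki : ∀ x ∈ Icc a b, ∀ y ∈ Icc a b,
      IntervalIntegrable (fun θ => M.f θ - l) volume x y := fun x hx y hy =>
    ((hfc.sub continuousOn_const).mono (uIcc_subset_Icc hx hy)).intervalIntegrable
  have hcont : ContinuousOn (fun s => ∫ θ in a..s, (M.f θ - l)) (Icc a b) :=
    (continuousOn_primitive ha).mono hsub
  have haI : a ∈ Icc a b := ⟨le_rfl, hab.le⟩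
  have hbI : b ∈ Icc a b := ⟨hab.le, le_rfl⟩
  -- The minimizer `t` of the primitive of `f - l` is interior: `f < l` near `a` and `f > l` near
  -- `b` make the primitive strictly larger at both ends.
  obtain ⟨t, ht, hmin⟩ := isCompact_Icc.exists_isMinOn ⟨a, haI⟩ hcont
  have hmin' : ∀ s ∈ Icc a b, 0 ≤ ∫ θ in t..s, (M.f θ - l) := by
    intro s hs
    rw [← intervalIntegral.integral_interval_sub_left (hki a haI s hs) (hki a haI t ht)]
    exact sub_nonneg.2 (hmin hs)
  have hleft : 0 < ∫ θ in t..a, (M.f θ - l) := by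
    have hev : ∀ᶠ θ in nhdsWithin a (Icc a b), M.f θ < l := (hfc a haI).eventually_lt_const hl₁
    rw [nhdsWithin_Icc_eq_nhdsGE hab] at hev
    obtain ⟨u, hu, hsubu⟩ := (mem_nhdsGE_iff_exists_Ico_subset' hab).1 hev
    have hd : min u b ∈ Icc a b := ⟨le_min (le_of_lt hu) hab.le, min_le_right _ _⟩
    have hneg : 0 < ∫ θ in a..min u b, -(M.f θ - l) := by
      refine intervalIntegral.intervalIntegral_pos_of_pos_on (hki a haI _ hd).neg ?_
        (lt_min hu hab)
      intro θ hθ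
      have : M.f θ < l := hsubu ⟨hθ.1.le, hθ.2.trans_le (min_le_left _ _)⟩
      linarith
    rw [intervalIntegral.integral_neg] at hneg
    have hadd := intervalIntegral.integral_add_adjacent_intervals (hki t ht a haI)
      (hki a haI _ hd)
    linarith [hmin' _ hd]
  have hright : 0 < ∫ θ in t..b, (M.f θ - l) := by
    have hev : ∀ᶠ θ in nhdsWithin b (Icc a b), l < M.f θ := (hfc b hbI).eventually_const_lt hl₂
    rw [nhdsWithin_Icc_eq_nhdsLE hab] at hev
    obtain ⟨u, hu, hsubu⟩ := (mem_nhdsLE_iff_exists_Ioc_subset' hab).1 hev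
    have hd : max u a ∈ Icc a b := ⟨le_max_right _ _, max_le (le_of_lt hu) hab.le⟩
    have hneg : 0 < ∫ θ in max u a..b, (M.f θ - l) := by
      refine intervalIntegral.intervalIntegral_pos_of_pos_on (hki _ hd b hbI) ?_
        (max_lt hu hab)
      intro θ hθ
      have : l < M.f θ := hsubu ⟨(le_max_left _ _).trans_lt hθ.1, hθ.2.le⟩
      linarith
    have hadd := intervalIntegral.integral_add_adjacent_intervals (hki t ht _ hd)
      (hki _ hd b hbI)
    linarith [hmin' _ hd]
  refine ⟨l, t, ⟨lt_of_le_of_ne ht.1 ?_, lt_of_le_of_ne ht.2 ?_⟩, hmin', hleft, hright⟩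
  · rintro rfl
    simp at hleft
  · rintro rfl
    simp at hright

/-- Full revelation is optimal only if the density is decreasing. -/
lemma antitoneOn_of_isBestMenu (hbest : M.IsBestMenu (M.lowerMenu 0)) :
    AntitoneOn M.f (Icc M.θlo M.θhi) := by
  intro a ha b hb hab
  by_contra hc
  have hf := not_le.1 hc
  have hab' : a < b := lt_of_le_of_ne hab fun h => hf.ne (by rw [h])
  obtain ⟨l, t, ht, hmin, hta, htb⟩ := exists_tangent_of_lt ha hb hab' hf
  obtain ⟨ya, hya, rfl⟩ := M.exists_marginalCost_eq (mem_Icc_zero ha)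
  obtain ⟨yb, hyb, rfl⟩ := M.exists_marginalCost_eq (mem_Icc_zero hb)
  obtain ⟨yt, hyt, rfl⟩ := M.exists_marginalCost_eq
    (mem_Icc_zero (M := M) ⟨ha.1.trans ht.1.le, ht.2.le.trans hb.2⟩)
  have hat : ya < yt := M.lt_of_marginalCost_lt hya hyt ht.1
  have htb' : yt < yb := M.lt_of_marginalCost_lt hyt hyb ht.2
  have hA := M.tangent_lt hyt hya hat.ne'
  have hB := M.tangent_lt hyt hyb htb'.ne
  have hchord : ∀ z, ContinuousOn (fun y => M.c y - M.c z - M.marginalCost yt * (y - z)) M.Q :=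
    fun z => (M.c_continuousOn.sub continuousOn_const).sub
      (continuousOn_const.mul (continuousOn_id.sub continuousOn_const))
  -- The gap must have `t` as its indifferent type. If the chord from `ya` to `yb` is too steep, its
  -- upper end is lowered towards `yt`; if too flat, its lower end is raised. The end that stays
  -- supplies the strict inequality.
  rcases le_total 0 (M.c yb - M.c ya - M.marginalCost yt * (yb - ya)) with hcase | hcase
  · obtain ⟨y₂, hy₂, heq⟩ := intermediate_value_Icc htb'.le
      ((hchord ya).mono (Icc_subset_Icc hyt.1 hyb.2)) ⟨by linarith, hcase⟩
    have hy₂Q : y₂ ∈ M.Q := ⟨hyt.1.trans hy₂.1, hy₂.2.trans hyb.2⟩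
    have hle : M.marginalCost y₂ ≤ M.marginalCost yb :=
      M.marginalCost_strictMonoOn.monotoneOn hy₂Q hyb hy₂.2
    exact not_isBestMenu_of_gap (l := l) hya hy₂Q (hat.trans_le hy₂.1) (by linarith) ha.1
      (hle.trans hb.2) (fun s hs => hmin s ⟨hs.1, hs.2.trans hle⟩)
      ⟨ya, ⟨le_rfl, hat.le.trans hy₂.1⟩, hta⟩ hbest
  · obtain ⟨y₁, hy₁, heq⟩ := intermediate_value_Icc' hat.le
      ((hchord yb).mono (Icc_subset_Icc hya.1 hyt.2))
      (show (0 : ℝ) ∈ Icc _ _ from ⟨by linarith, by linarith⟩)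
    have hy₁Q : y₁ ∈ M.Q := ⟨hya.1.trans hy₁.1, hy₁.2.trans hyt.2⟩
    have hle : M.marginalCost ya ≤ M.marginalCost y₁ :=
      M.marginalCost_strictMonoOn.monotoneOn hya hy₁Q hy₁.1
    exact not_isBestMenu_of_gap (l := l) hy₁Q hyb (hy₁.2.trans_lt htb') (by linarith)
      (ha.1.trans hle) hb.2 (fun s hs => hmin s ⟨hle.trans hs.1, hs.2⟩)
      ⟨yb, ⟨hy₁.2.trans htb'.le, le_rfl⟩, htb⟩ hbest

/-! ### The optimal ratings -/

lemma Unimodal.exists_unimodalAt (h : M.Unimodal) : ∃ m, M.UnimodalAt m := by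
  obtain ⟨m, hm, h1, h2⟩ := h
  exact ⟨m, hm, h1, h2⟩

lemma isBestMenu_passMenu {x : ℝ} (hx : x ∈ M.Q) (h : M.θhi ≤ M.marginalCost x)
    (hbest : M.IsBestMenu (M.lowerMenu x)) : M.IsBestMenu (passMenu x) :=
  fun D hD => (hbest D hD).trans (menuValue_lowerMenu_le_passMenu hx h)

/-- A pass/fail test is optimal if the range of types is small. -/
lemma UnimodalAt.exists_isBestMenu_passMenu {m : ℝ} (hm : M.UnimodalAt m)
    (h : M.θhi ≤ M.thetaC M.θlo) : ∃ x ∈ M.Q, M.IsBestMenu (passMenu x) := by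
  obtain ⟨x, hx, -, -, hbest⟩ := hm.exists_isBestMenu
  obtain ⟨y, hy, hcut⟩ := M.exists_cutoff_eq (mem_Icc_zero (M := M) θlo_mem)
  rw [← hcut, M.thetaC_cutoff hy] at h
  -- The standard `y` excludes nobody, so raising a lower best standard to `y` costs nothing; the
  -- larger of the two has marginal cost at least `θhi`.
  rcases le_total y x with hyx | hxy
  · exact ⟨x, hx, isBestMenu_passMenu hx
      (h.trans (M.marginalCost_strictMonoOn.monotoneOn hy hx hyx)) hbest⟩
  · exact ⟨y, hy, isBestMenu_passMenu hy h fun D hD =>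
      (hbest D hD).trans (menuValue_lowerMenu_le hx hy hxy hcut.le)⟩

lemma unimodalAt_of_monotoneOn (h : MonotoneOn M.f (Icc M.θlo M.θhi)) :
    M.UnimodalAt M.θhi :=
  ⟨θhi_mem, h, by rw [Icc_self]; exact subsingleton_singleton.antitoneOn _⟩

lemma unimodalAt_of_antitoneOn (h : AntitoneOn M.f (Icc M.θlo M.θhi)) :
    M.UnimodalAt M.θlo :=
  ⟨θlo_mem, by rw [Icc_self]; exact subsingleton_singleton.monotoneOn _, h⟩

end

end RatingModel

theorem mainTheorem2 (M : RatingModel) :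
    -- lower censorship is optimal if the density is unimodal
    (M.Unimodal →
      ∃ q₀ ∈ M.Q, ∃ q, M.IsOptimal RatingModel.quality (RatingModel.lowerCensorship q₀) q) ∧
    -- pass/fail is optimal if the density is increasing, or the range of types is small
    ((MonotoneOn M.f (Set.Icc M.θlo M.θhi) ∨ (M.Unimodal ∧ M.θhi ≤ M.thetaC M.θlo)) →
      ∃ q₀ ∈ M.Q, ∃ q, M.IsOptimal RatingModel.quality (RatingModel.passFail q₀) q) ∧
    -- lower censorship without exclusion is optimal if the density is decreasing
    (AntitoneOn M.f (Set.Icc M.θlo M.θhi) →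
      ∃ q₀ ∈ M.Q, ∃ q, M.IsOptimal RatingModel.quality (RatingModel.lowerCensorship q₀) q ∧
        M.cutoff q₀ ≤ M.θlo ∧ M.NoExclusion q) ∧
    -- the fully revealing test is optimal iff the density is decreasing and the lowest type is 0
    ((∃ q, M.IsOptimal RatingModel.quality RatingModel.fullyRevealing q) ↔
      AntitoneOn M.f (Set.Icc M.θlo M.θhi) ∧ M.θlo = 0) ∧
    -- for every mode there is an optimal cutoff type in `[θ_c⁻¹(θ_m), θ_m]`
    (M.Unimodal → ∀ m, M.IsMode m →
      ∃ q₀ ∈ M.Q, (∃ q, M.IsOptimal RatingModel.quality (RatingModel.lowerCensorship q₀) q) ∧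
        M.cutoff q₀ ∈ Set.Icc (M.thetaCInv m) m) ∧
    -- every optimal cutoff type is in `[θ_c⁻¹(θ_m), θ_m]` for some mode (thus for the mode, if unique)
    (M.Unimodal → ∀ q₀ ∈ M.Q,
      ((∃ q, M.IsOptimal RatingModel.quality (RatingModel.lowerCensorship q₀) q) ∨
        (∃ q, M.IsOptimal RatingModel.quality (RatingModel.passFail q₀) q)) →
      ∃ m, M.IsMode m ∧ M.cutoff q₀ ∈ Set.Icc (M.thetaCInv m) m) := by
  refine ⟨?_, ?_, ?_, ?_, ?_, ?_⟩
  · intro h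
    obtain ⟨m, hm⟩ := h.exists_unimodalAt
    obtain ⟨x, hx, -, -, hbest⟩ := hm.exists_isBestMenu
    exact ⟨x, hx, _, RatingModel.isOptimal_lowerCensorship hx hbest⟩
  · rintro (h | ⟨h, hc⟩)
    · obtain ⟨x, hx, hmc, -, hbest⟩ := (RatingModel.unimodalAt_of_monotoneOn h).exists_isBestMenu
      exact ⟨x, hx, _,
        RatingModel.isOptimal_passFail hx (RatingModel.isBestMenu_passMenu hx hmc hbest)⟩
    · obtain ⟨m, hm⟩ := h.exists_unimodalAt
      obtain ⟨x, hx, hbest⟩ := hm.exists_isBestMenu_passMenu hc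
      exact ⟨x, hx, _, RatingModel.isOptimal_passFail hx hbest⟩
  · intro h
    obtain ⟨x, hx, -, hcut, hbest⟩ := (RatingModel.unimodalAt_of_antitoneOn h).exists_isBestMenu
    refine ⟨x, hx, _, RatingModel.isOptimal_lowerCensorship hx hbest, hcut, fun θ hθ => ?_⟩
    exact RatingModel.sel_lowerMenu_pos hx hθ θ.2.2 (hcut.trans θ.2.1)
  · constructor
    · rintro ⟨q, hq⟩
      have hbest : M.IsBestMenu (M.lowerMenu 0) := hq.isBestMenu
        (RatingModel.payoff_of_induces_lowerCensorship M.zero_mem_Q hq.1)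
      refine ⟨RatingModel.antitoneOn_of_isBestMenu hbest, le_antisymm ?_ M.θlo_nonneg⟩
      by_contra hc
      refine RatingModel.not_isBestMenu_of_marginalCost_lt M.zero_mem_Q ?_ hbest
      rw [M.marginalCost_zero]
      exact not_le.1 hc
    · rintro ⟨h, h0⟩
      obtain ⟨x, hx, -, hcut, hbest⟩ := (RatingModel.unimodalAt_of_antitoneOn h).exists_isBestMenu
      have hx0 : x = 0 := by
        refine le_antisymm ?_ hx.1
        rwa [← M.cutoff_strictMonoOn.le_iff_le hx M.zero_mem_Q, M.cutoff_zero, ← h0]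
      subst hx0
      exact ⟨_, RatingModel.isOptimal_lowerCensorship hx hbest⟩
  · intro h m hm
    obtain ⟨x, hx, hmc, hcut, hbest⟩ := (h.unimodalAt hm).exists_isBestMenu
    exact ⟨x, hx, ⟨_, RatingModel.isOptimal_lowerCensorship hx hbest⟩,
      M.thetaCInv_le_cutoff (RatingModel.mem_Icc_zero hm.1) hx hmc, hcut⟩
  · intro h x hx hopt
    have hbest : M.IsBestMenu (M.lowerMenu x) := by
      rcases hopt with ⟨q, hq⟩ | ⟨q, hq⟩
      · exact hq.isBestMenu (RatingModel.payoff_of_induces_lowerCensorship hx hq.1)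
      -- Lower censorship with the same standard is at least as good as the pass/fail test, so it is
      -- optimal as well.
      · exact fun D hD => (hq.isBestMenu (RatingModel.payoff_of_induces_passFail hx hq.1) D hD).trans
          (RatingModel.menuValue_passMenu_le hx)
    obtain ⟨m, hm, hcut, hmc⟩ := h.exists_mode_of_isBestMenu hx hbest
    exact ⟨m, hm, M.thetaCInv_le_cutoff (RatingModel.mem_Icc_zero hm.1) hx hmc, hcut⟩
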